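/- Let $\alpha>0$, $\delta\in(0,\alpha)$, $\kappa\ge 0$ and $C\ge 1$ be real numbers and let $m\ge 1$ be an integer. Let $1\le\lambda_1<\lambda_2<\cdots$ be a sequence of real numbers tending to infinity and let $(a_n)_{n\ge1}$ be a sequence of non-negative real numbers. We say that $A(s)=\sum_{n\ge1}a_n\lambda_n^{-s}$ satisfies Hypothesis B for $\alpha,\delta,\kappa,m$ with constant $C$ if the series converges in some right half-plane and can be analytically continued to the closed half-plane $\Re(s)\ge\alpha-\delta$ aside from a pole of order $m$ at the real point $s=\alpha$; if moreover, for some $M_1,M_2\ge0$, $$|(s-\alpha)^mA(s)|\le M_1\exp(|s|^{M_2})\qquad\text{for all } s\ne\alpha \text{ in the strip }\alpha-\delta\le\Re(s)\le\alpha;$$ and if $$|A(s)|\le C\,(1+|\Im(s)|)^{\kappa}\,(\log(3+|\Im(s)|))^{m-1}\qquad\text{for }\Re(s)=\alpha-\delta.$$ Then the following hold. (i) Let $b\ge1$, and assume $b>1$ if $m\ge2$. There is a constant $K>0$, depending only on $\alpha,\delta,\kappa,m,C$ and $b$, such that for every series $A(s)=\sum_n a_n\lambda_n^{-s}$ satisfying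 Hypothesis B for $\alpha,\delta,\kappa,m$ with constant $C$, and for every $n\ge1$ with $\lambda_n\ge b$, $$0\le a_n\le K\,\lambda_n^{\alpha-\frac{\delta}{\kappa+1}}(\log\lambda_n)^{m-1}.$$ (Here $(\log\lambda_n)^{0}=1$.) (ii) In particular, for every series $A(s)$ satisfying Hypothesis B for $\alpha,\delta,\kappa,m$ with constant $C$, there is a constant $K>0$ such that for every $n\ge2$, $$0\le a_n\le K\,\lambda_n^{\alpha-\frac{\delta}{\kappa+1}}(\log\lambda_n)^{m-1}.$$ -/

import Mathlib

/-- A frequency sequence `1 ≤ λ₁ < λ₂ < ⋯` of real numbers tending to infinity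
(indexed by the positive integers). -/
structure IsFrequencySeq (lam : ℕ+ → ℝ) : Prop where
  one_le : 1 ≤ lam 1
  strictMono : StrictMono lam
  tendsto : Filter.Tendsto lam Filter.atTop Filter.atTop

/-- The `n`-th term `aₙ λₙ^{-s}` of the general Dirichlet series with real coefficients `a`
and frequencies `lam`. -/
noncomputable def genDirichletTerm (lam a : ℕ+ → ℝ) (s : ℂ) (n : ℕ+) : ℂ :=
  (a n : ℂ) * (lam n : ℂ) ^ (-s)

/-- `F` is a continuation of the general Dirichlet series `∑ aₙ λₙ^{-s}` to the closed half-plane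
`Re s ≥ α - δ`, aside from a pole of order `m` at the real point `s = α`: the series converges to
`F` in some right half-plane, `F` is analytic at every point `s ≠ α` of the closed half-plane, and
`F` is meromorphic at `α` of order `-m`.
(By the identity theorem `F` is unique on the closed half-plane without `α`.) -/
structure IsContinuationWithPole (α δ : ℝ) (m : ℕ) (lam a : ℕ+ → ℝ) (F : ℂ → ℂ) : Prop where
  hasSum : ∃ σ₀ : ℝ, ∀ s : ℂ, σ₀ < s.re → HasSum (genDirichletTerm lam a s) (F s)
  analytic : AnalyticOnNhd ℂ F ({s : ℂ | α - δ ≤ s.re} \ {(α : ℂ)})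
  meromorphicAt : MeromorphicAt F (α : ℂ)
  order_eq : meromorphicOrderAt F (α : ℂ) = ((-(m : ℤ) : ℤ) : WithTop ℤ)

/-- Hypothesis B for `α, δ, κ, m`, with the constant `C` in the growth condition made explicit:
the general Dirichlet series `A(s) = ∑ aₙ λₙ^{-s}` has non-negative coefficients, it continues
analytically to `Re s ≥ α - δ` aside from a pole of order `m` at `s = α`, the function
`(s - α)^m A(s)` is at most `M₁ exp(|s|^{M₂})` in the strip `α - δ ≤ Re s ≤ α` for some
`M₁, M₂ ≥ 0`, and `|A(s)| ≤ C (1 + |Im s|)^κ (log (3 + |Im s|))^{m-1}` on `Re s = α - δ`. -/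
structure HypothesisB (α δ κ : ℝ) (m : ℕ) (C : ℝ) (lam a : ℕ+ → ℝ) : Prop where
  frequency : IsFrequencySeq lam
  nonneg : ∀ n, 0 ≤ a n
  continuation : ∃ F : ℂ → ℂ,
    IsContinuationWithPole α δ m lam a F ∧
    (∃ M₁ M₂ : ℝ, 0 ≤ M₁ ∧ 0 ≤ M₂ ∧ ∀ s : ℂ, α - δ ≤ s.re → s.re ≤ α → s ≠ (α : ℂ) →
      ‖(s - (α : ℂ)) ^ m * F s‖ ≤ M₁ * Real.exp (‖s‖ ^ M₂)) ∧
    (∀ s : ℂ, s.re = α - δ →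
      ‖F s‖ ≤ C * (1 + |s.im|) ^ κ * (Real.log (3 + |s.im|)) ^ (m - 1))

/-! Isolate one coefficient by Gaussian smoothing. Put `y = log λₙ` and integrate `A(α + w)
exp(h²w²/2 + wy)` over `Re w = 1`. Each term of the series contributes a non-negative Gaussian in
`(y - log λₖ)/h`, and the term `k = n` alone bounds `aₙ λₙ^{-α}` by `h` times the integral
(`coeff_le_norm_integral`). Now move the line to `Re s = α - δ`, indented around the pole at scale
`1/(1 + y)` (`norm_integral_vertical_le_of_indented`). The indentation costs `(1 + y)^{m-1}`, and
the line costs `e^{-δy} h^{-(κ+1)} log(3 + 1/h)^{m-1}` (`norm_integral_le`). The choice `h =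
λₙ^{-δ/(κ+1)}` balances the two, and the factor `h` is the saving in the exponent.

The constant may depend neither on `M₁`, `M₂` nor on the polar part of `A`, so a uniform bound for
`(s - α)^m A(s)` near the pole is needed; this is `exists_uniform_strip_bound`. Landau's theorem
gives convergence for `Re s > α`, hence `|A(s)| ≤ A(α + 1)` on `Re s = α + 2`. Phragmén–Lindelöf
with an exponential tilt then bounds `A(α + 1)` by the larger of a constant and half of itself, so
by the constant; an untilted second application covers the strip. The finite order required to the
right of `α` comes from the maximum principle on rectangles (`norm_le_of_maximum_principle_rect`).
-/

lemma norm_genDirichletTerm {lam a : ℕ+ → ℝ} {n : ℕ+} (hl : 0 < lam n) (ha : 0 ≤ a n) (s : ℂ) :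
    ‖genDirichletTerm lam a s n‖ = a n * lam n ^ (-s.re) := by
  rw [genDirichletTerm, norm_mul, Complex.norm_cpow_eq_rpow_re_of_pos hl, Complex.norm_real,
    Real.norm_of_nonneg ha, Complex.neg_re]

lemma genDirichletTerm_ofReal {lam a : ℕ+ → ℝ} {n : ℕ+} (hl : 0 < lam n) (x : ℝ) :
    genDirichletTerm lam a (x : ℂ) n = ((a n * lam n ^ (-x) : ℝ) : ℂ) := by
  rw [genDirichletTerm, Complex.ofReal_mul, Complex.ofReal_cpow hl.le]
  simp

lemma IsFrequencySeq.one_le' {lam : ℕ+ → ℝ} (h : IsFrequencySeq lam) (n : ℕ+) : 1 ≤ lam n :=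
  h.one_le.trans (h.strictMono.monotone _root_.one_le)

lemma IsFrequencySeq.pos {lam : ℕ+ → ℝ} (h : IsFrequencySeq lam) (n : ℕ+) : 0 < lam n :=
  one_pos.trans_le (h.one_le' n)

/-! ### Landau's theorem. -/

/-- A power series expansion near `0` remains valid on every disc where the function is
holomorphic. -/
lemma hasSum_powerSeries_of_differentiableOn_ball {f : ℂ → ℂ} {b : ℕ → ℂ} {ρ R : ℝ} (hρ : 0 < ρ)
    (hb : ∀ u : ℂ, ‖u‖ < ρ → HasSum (fun k => b k * u ^ k) (f u))
    (hf : DifferentiableOn ℂ f (Metric.ball 0 R)) {u : ℂ} (hu : ‖u‖ < R) :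
    HasSum (fun k => b k * u ^ k) (f u) := by
  obtain ⟨r, hur, hrR⟩ := exists_between hu
  have hr0 : 0 < r := (norm_nonneg u).trans_lt hur
  lift r to NNReal using hr0.le
  have h1 := (hf.mono (Metric.closedBall_subset_ball hrR)).hasFPowerSeriesOnBall
    (by exact_mod_cast hr0)
  have h2 : HasFPowerSeriesAt f (FormalMultilinearSeries.ofScalars ℂ b) 0 := by
    rw [hasFPowerSeriesAt_iff]
    filter_upwards [Metric.ball_mem_nhds (0 : ℂ) hρ] with z hz
    have := hb z (by simpa using hz)
    simpa [FormalMultilinearSeries.coeff_ofScalars, mul_comm] using this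
  rw [h1.hasFPowerSeriesAt.eq_formalMultilinearSeries h2] at h1
  have h3 := h1.hasSum (y := u) (by simpa [Metric.eball_coe] using hur)
  simpa [FormalMultilinearSeries.ofScalars_apply_eq, mul_comm] using h3

lemma hasSum_of_forall_eq {ι E : Type*} [AddCommMonoid E] [TopologicalSpace E] {f g : ι → E}
    {x : E} (h : HasSum f x) (e : ∀ k, f k = g k) : HasSum g x := by
  rwa [← funext e]

lemma hasSum_rpow_add {l : ℝ} (hl : 0 < l) (x u : ℝ) :
    HasSum (fun k : ℕ => l ^ x * (Real.log l ^ k / k.factorial) * u ^ k) (l ^ (x + u)) := by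
  have h := (NormedSpace.expSeries_div_hasSum_exp (𝔸 := ℝ) (Real.log l * u)).mul_left (l ^ x)
  rw [← congrFun Real.exp_eq_exp_ℝ] at h
  rw [Real.rpow_add hl, Real.rpow_def_of_pos hl u]
  refine hasSum_of_forall_eq h fun k => ?_
  rw [mul_pow]; ring

lemma hasSum_cpow_add {l : ℝ} (hl : 0 < l) (x : ℝ) (u : ℂ) :
    HasSum (fun k : ℕ => ((l ^ x * (Real.log l ^ k / k.factorial) : ℝ) : ℂ) * u ^ k)
      ((l : ℂ) ^ ((x : ℂ) + u)) := by
  have h := (NormedSpace.expSeries_div_hasSum_exp (𝔸 := ℂ) (Real.log l * u)).mul_left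
    ((l : ℂ) ^ (x : ℂ))
  rw [← congrFun Complex.exp_eq_exp_ℂ] at h
  have hl' : (l : ℂ) ≠ 0 := by exact_mod_cast hl.ne'
  rw [Complex.cpow_add _ _ hl', Complex.cpow_def_of_ne_zero hl' u, ← Complex.ofReal_log hl.le]
  refine hasSum_of_forall_eq h fun k => ?_
  push_cast
  rw [mul_pow, Complex.ofReal_cpow hl.le]; ring

lemma rpow_mul_log_pow_nonneg {l : ℝ} (hl : 1 ≤ l) (x : ℝ) (k : ℕ) :
    0 ≤ l ^ x * (Real.log l ^ k / k.factorial) := by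
  have := Real.log_nonneg hl
  positivity

/-- Landau's argument: the Taylor coefficients of `F(c - u)` at a real point `c` far to the right
are sums of non-negative reals. The Taylor series converges on the disc of radius `c - α`, in
particular at `u = c - x > 0`, where non-negativity allows the double sum to be read in the other
order. -/
lemma summable_genDirichlet_of_differentiableOn {lam a : ℕ+ → ℝ} {F : ℂ → ℂ} {α σ₀ : ℝ}
    (hlam : IsFrequencySeq lam) (ha : ∀ n, 0 ≤ a n)
    (hsum : ∀ s : ℂ, σ₀ < s.re → HasSum (genDirichletTerm lam a s) (F s))
    (hF : DifferentiableOn ℂ F {s | α < s.re}) {x : ℝ} (hx : α < x) :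
    Summable fun n => a n * lam n ^ (-x) := by
  -- The unit disc around `c` lies in the half-plane `Re s > σ₀` of known convergence, and `x` lies
  -- to the left of `c`.
  set c : ℝ := max σ₀ x + 1 with hc
  have hcσ : σ₀ + 1 ≤ c := by have := le_max_left σ₀ x; linarith
  have hcx : x + 1 ≤ c := by have := le_max_right σ₀ x; linarith
  set d : ℕ+ → ℕ → ℝ := fun n k => a n * (lam n ^ (-c) * (Real.log (lam n) ^ k / k.factorial))
    with hd
  have hd0 : ∀ n k, 0 ≤ d n k := fun n k =>
    mul_nonneg (ha n) (rpow_mul_log_pow_nonneg (hlam.one_le' n) _ _)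
  have hreal : ∀ n (u : ℝ), HasSum (fun k => d n k * u ^ k) (a n * lam n ^ (-c + u)) := by
    intro n u
    refine hasSum_of_forall_eq ((hasSum_rpow_add (hlam.pos n) (-c) u).mul_left (a n)) fun k => ?_
    simp only [hd]; ring
  have hcplx : ∀ n (u : ℂ), HasSum (fun k => (d n k : ℂ) * u ^ k)
      (genDirichletTerm lam a (c - u) n) := by
    intro n u
    have h := (hasSum_cpow_add (hlam.pos n) (-c) u).mul_left (a n : ℂ)
    have e : (a n : ℂ) * (lam n : ℂ) ^ (((-c : ℝ) : ℂ) + u) = genDirichletTerm lam a (c - u) n := by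
      rw [genDirichletTerm]; congr 2; push_cast; ring
    rw [e] at h
    refine hasSum_of_forall_eq h fun k => ?_
    simp only [hd]; push_cast; ring
  have hprod : ∀ u : ℝ, 0 ≤ u → u < 1 →
      Summable fun p : ℕ+ × ℕ => d p.1 p.2 * u ^ p.2 := by
    intro u hu hu1
    refine (summable_prod_of_nonneg fun p => mul_nonneg (hd0 _ _) (pow_nonneg hu _)).mpr
      ⟨fun n => (hreal n u).summable, ?_⟩
    have h := (hsum ((c - u : ℝ) : ℂ) (by rw [Complex.ofReal_re]; linarith)).summable
    rw [funext fun n => genDirichletTerm_ofReal (a := a) (hlam.pos n) (c - u)] at h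
    rw [Complex.summable_ofReal] at h
    refine h.congr fun n => ?_
    rw [(hreal n u).tsum_eq]; congr 2; ring
  have hcol : ∀ k, Summable fun n => d n k := by
    intro k
    have h := ((hprod (1 / 2) (by norm_num) (by norm_num)).prod_symm.prod_factor k).mul_right
      (((1 / 2 : ℝ) ^ k)⁻¹)
    refine h.congr fun n => ?_
    simp
  have hpow : ∀ u : ℂ, ‖u‖ < 1 →
      HasSum (fun k => ((∑' n, d n k : ℝ) : ℂ) * u ^ k) (F (c - u)) := by
    intro u hu
    have hs : Summable fun p : ℕ+ × ℕ => (d p.1 p.2 : ℂ) * u ^ p.2 := by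
      refine Summable.of_norm ((hprod ‖u‖ (norm_nonneg u) hu).congr fun p => ?_)
      rw [norm_mul, norm_pow, Complex.norm_real, Real.norm_of_nonneg (hd0 _ _)]
    have h1 := hs.hasSum.prod_fiberwise fun n => hcplx n u
    have h2 := hsum (c - u) (by
      have := Complex.re_le_norm u
      simp only [Complex.sub_re, Complex.ofReal_re]; linarith)
    have h3 := h1.unique h2
    have h4 := hs.prod_symm.hasSum.prod_fiberwise
      (g := fun k => ((∑' n, d n k : ℝ) : ℂ) * u ^ k) fun k => by
        have := (Complex.hasSum_ofReal.mpr (hcol k).hasSum).mul_right (u ^ k)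
        exact this
    have h5 : ∑' p : ℕ × ℕ+, (fun p : ℕ+ × ℕ => (d p.1 p.2 : ℂ) * u ^ p.2) p.swap = F (c - u) := by
      rw [← h3]; exact (Equiv.prodComm ℕ ℕ+).tsum_eq (fun p : ℕ+ × ℕ => (d p.1 p.2 : ℂ) * u ^ p.2)
    rw [← h5]; exact h4
  have hball : DifferentiableOn ℂ (fun u => F (c - u)) (Metric.ball 0 (c - α)) := by
    refine hF.comp (by fun_prop) fun u hu => ?_
    have h1 := Complex.re_le_norm u
    have h2 : ‖u‖ < c - α := by simpa using hu
    simp only [Set.mem_ofPred_eq, Complex.sub_re, Complex.ofReal_re]; linarith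
  have hv : 0 ≤ c - x := by linarith
  have hbig := (hasSum_powerSeries_of_differentiableOn_ball one_pos hpow hball
    (u := ((c - x : ℝ) : ℂ)) (by
      rw [Complex.norm_real, Real.norm_of_nonneg hv]; linarith)).summable
  have hbig' : Summable fun k => (∑' n, d n k) * (c - x) ^ k := by
    rw [← Complex.summable_ofReal]
    refine hbig.congr fun k => ?_
    push_cast; ring
  -- Every finite partial sum over `n` is dominated, Taylor coefficient by Taylor coefficient, by
  -- the series for `F` at `x`.
  refine summable_of_sum_le (c := ∑' k, (∑' n, d n k) * (c - x) ^ k)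
    (fun n => mul_nonneg (ha n) (Real.rpow_nonneg (hlam.pos n).le _)) fun S => ?_
  have h6 : HasSum (fun k => ∑ n ∈ S, d n k * (c - x) ^ k) (∑ n ∈ S, a n * lam n ^ (-x)) := by
    refine hasSum_sum fun n _ => ?_
    have := hreal n (c - x)
    rwa [show -c + (c - x) = -x by ring] at this
  refine hasSum_le (fun k => ?_) h6 hbig'.hasSum
  rw [← Finset.sum_mul]
  exact mul_le_mul_of_nonneg_right ((hcol k).sum_le_tsum S fun n _ => hd0 n k)
    (pow_nonneg hv _)

lemma isOpen_re_gt (x : ℝ) : IsOpen {s : ℂ | x < s.re} :=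
  isOpen_lt continuous_const Complex.continuous_re

lemma summable_genDirichletTerm {lam a : ℕ+ → ℝ} {σ : ℝ}
    (hlam : IsFrequencySeq lam) (ha : ∀ n, 0 ≤ a n)
    (hs : Summable fun n => a n * lam n ^ (-σ)) {s : ℂ} (hσ : σ ≤ s.re) :
    Summable (genDirichletTerm lam a s) := by
  refine Summable.of_norm_bounded hs fun n => ?_
  rw [norm_genDirichletTerm (hlam.pos n) (ha n)]
  exact mul_le_mul_of_nonneg_left
    (Real.rpow_le_rpow_of_exponent_le (hlam.one_le' n) (by linarith)) (ha n)

lemma differentiableOn_genDirichlet {lam a : ℕ+ → ℝ} {α : ℝ}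
    (hlam : IsFrequencySeq lam) (ha : ∀ n, 0 ≤ a n)
    (hs : ∀ x, α < x → Summable fun n => a n * lam n ^ (-x)) :
    DifferentiableOn ℂ (fun s => ∑' n, genDirichletTerm lam a s n) {s | α < s.re} := by
  intro s hsα
  obtain ⟨x, hx, hxs⟩ := exists_between (show α < s.re from hsα)
  have h := Complex.differentiableOn_tsum_of_summable_norm (F := fun n s => genDirichletTerm lam a s n)
    (U := {s | x < s.re}) (hs x hx)
    (fun n => by
      have : (lam n : ℂ) ≠ 0 := by exact_mod_cast (hlam.pos n).ne'
      simp only [genDirichletTerm]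
      exact (((differentiable_id.neg).const_cpow (Or.inl this)).const_mul _).differentiableOn)
    (isOpen_re_gt x) fun n w hw => by
      rw [norm_genDirichletTerm (hlam.pos n) (ha n)]
      exact mul_le_mul_of_nonneg_left
        (Real.rpow_le_rpow_of_exponent_le (hlam.one_le' n) (by
          have : x < w.re := hw
          linarith)) (ha n)
  exact (h.differentiableAt ((isOpen_re_gt x).mem_nhds hxs)).differentiableWithinAt

/-- **Landau's theorem** for general Dirichlet series with non-negative coefficients. -/
theorem hasSum_genDirichlet_of_differentiableOn {lam a : ℕ+ → ℝ} {F : ℂ → ℂ} {α σ₀ : ℝ}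
    (hlam : IsFrequencySeq lam) (ha : ∀ n, 0 ≤ a n)
    (hsum : ∀ s : ℂ, σ₀ < s.re → HasSum (genDirichletTerm lam a s) (F s))
    (hF : DifferentiableOn ℂ F {s | α < s.re}) {s : ℂ} (hs : α < s.re) :
    HasSum (genDirichletTerm lam a s) (F s) := by
  have hsm : ∀ x, α < x → Summable fun n => a n * lam n ^ (-x) := fun x hx =>
    summable_genDirichlet_of_differentiableOn hlam ha hsum hF hx
  have heq : Set.EqOn F (fun s => ∑' n, genDirichletTerm lam a s n) {s | α < s.re} := by
    set p : ℂ := ((max α σ₀ + 1 : ℝ) : ℂ) with hp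
    have hpα : α < p.re := by
      have := le_max_left α σ₀; rw [hp, Complex.ofReal_re]; linarith
    have hpσ : σ₀ < p.re := by
      have := le_max_right α σ₀; rw [hp, Complex.ofReal_re]; linarith
    refine (hF.analyticOnNhd (isOpen_re_gt α)).eqOn_of_preconnected_of_eventuallyEq
      ((differentiableOn_genDirichlet hlam ha hsm).analyticOnNhd (isOpen_re_gt α))
      (convex_halfSpace_re_gt α).isPreconnected hpα ?_
    filter_upwards [(isOpen_re_gt σ₀).mem_nhds hpσ] with z hz
    exact (hsum z hz).tsum_eq.symm
  rw [heq hs]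
  exact (summable_genDirichletTerm hlam ha (hsm s.re hs) le_rfl).hasSum

/-! ### Phragmén–Lindelöf for functions of finite order. -/

section Growth

open Filter Topology Asymptotics

/-- A power of `|Im z|` is eventually below `exp (c |Im z|)` for every `c > 0`, so finite order is
well within the double-exponential growth that Phragmén–Lindelöf tolerates. -/
lemma isBigO_exp_exp_of_norm_le {f : ℂ → ℂ} {a b c B q M : ℝ} (hc : 0 < c)
    (hB : ∀ z : ℂ, a < z.re → z.re < b → ‖f z‖ ≤ B * Real.exp ((|z.im| + q) ^ M)) :
    f =O[comap (_root_.abs ∘ Complex.im) atTop ⊓ 𝓟 (Complex.re ⁻¹' Set.Ioo a b)]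
      fun z => Real.exp (1 * Real.exp (c * |z.im|)) := by
  have h1 : ∀ᶠ x : ℝ in atTop, (x + q) ^ M ≤ Real.exp (c * x) := by
    have h := (isLittleO_rpow_exp_pos_mul_atTop M hc).comp_tendsto
      (tendsto_atTop_add_const_right atTop q tendsto_id)
    have h2 := (h.def (c := Real.exp (-(c * q))) (Real.exp_pos _))
    filter_upwards [h2] with x hx
    simp only [Function.comp, id, Real.norm_eq_abs, Real.abs_exp] at hx
    refine (le_abs_self _).trans (hx.trans_eq ?_)
    rw [← Real.exp_add]; congr 1; ring
  refine IsBigO.of_bound |B| ?_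
  have h3 : ∀ᶠ z : ℂ in comap (_root_.abs ∘ Complex.im) atTop,
      (|z.im| + q) ^ M ≤ Real.exp (c * |z.im|) := tendsto_comap.eventually h1
  filter_upwards [h3.filter_mono inf_le_left, mem_inf_of_right (mem_principal_self _)] with z hz hz'
  refine (hB z hz'.1 hz'.2).trans ?_
  rw [Real.norm_eq_abs, Real.abs_exp, one_mul]
  exact mul_le_mul (le_abs_self B) (Real.exp_le_exp.mpr hz) (Real.exp_pos _).le (abs_nonneg B)

/-- Phragmén–Lindelöf in a vertical strip for functions of finite order. -/
lemma norm_le_of_finite_order_vertical_strip {f : ℂ → ℂ} {a b C B q M : ℝ} (hab : a < b)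
    (hf : DifferentiableOn ℂ f {z | a ≤ z.re})
    (hB : ∀ z : ℂ, a < z.re → z.re < b → ‖f z‖ ≤ B * Real.exp ((|z.im| + q) ^ M))
    (ha : ∀ z : ℂ, z.re = a → ‖f z‖ ≤ C) (hb : ∀ z : ℂ, z.re = b → ‖f z‖ ≤ C)
    {z : ℂ} (hza : a ≤ z.re) (hzb : z.re ≤ b) : ‖f z‖ ≤ C := by
  have hba : 0 < b - a := sub_pos.mpr hab
  have hpi : 0 < Real.pi / (b - a) := div_pos Real.pi_pos hba
  refine PhragmenLindelof.vertical_strip (DifferentiableOn.diffContOnCl (hf.mono ?_))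
    ⟨Real.pi / (b - a) / 2, half_lt_self hpi, 1, isBigO_exp_exp_of_norm_le (half_pos hpi) hB⟩
    ha hb hza hzb
  refine closure_minimal (fun w hw => hw.1.le) (isClosed_le continuous_const Complex.continuous_re)

/-! ### The continuation to the right of the pole. -/

section Continuation

variable {α δ κ C : ℝ} {m : ℕ} {lam a : ℕ+ → ℝ} {F : ℂ → ℂ}

lemma IsContinuationWithPole.differentiableOn_re_gt (hδ : 0 < δ)
    (h : IsContinuationWithPole α δ m lam a F) : DifferentiableOn ℂ F {s | α < s.re} := by
  refine h.analytic.differentiableOn.mono fun s hs => ?_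
  have hs' : α < s.re := hs
  refine ⟨by show α - δ ≤ s.re; linarith, ?_⟩
  rintro rfl
  simp at hs'

lemma IsContinuationWithPole.hasSum_of_re_gt (hδ : 0 < δ) (hlam : IsFrequencySeq lam)
    (ha : ∀ n, 0 ≤ a n) (h : IsContinuationWithPole α δ m lam a F) {s : ℂ} (hs : α < s.re) :
    HasSum (genDirichletTerm lam a s) (F s) := by
  obtain ⟨σ₀, hσ⟩ := h.hasSum
  exact hasSum_genDirichlet_of_differentiableOn hlam ha hσ (h.differentiableOn_re_gt hδ) hs

lemma IsContinuationWithPole.norm_le_norm_ofReal (hδ : 0 < δ) (hlam : IsFrequencySeq lam)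
    (ha : ∀ n, 0 ≤ a n) (h : IsContinuationWithPole α δ m lam a F) {σ : ℝ} {s : ℂ}
    (hσ : α < σ) (hs : σ ≤ s.re) : ‖F s‖ ≤ ‖F σ‖ := by
  have h1 := h.hasSum_of_re_gt hδ hlam ha (s := s) (by linarith)
  have h2 := h.hasSum_of_re_gt hδ hlam ha (s := (σ : ℂ)) (by simpa using hσ)
  rw [funext fun n => genDirichletTerm_ofReal (a := a) (hlam.pos n) σ] at h2
  have h3 : Summable fun n => a n * lam n ^ (-σ) := Complex.summable_ofReal.mp h2.summable
  have h4 := h2.unique (Complex.hasSum_ofReal.mpr h3.hasSum)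
  rw [h4, Complex.norm_real]
  refine le_trans ?_ (Real.le_norm_self _)
  rw [← h1.tsum_eq]
  refine tsum_of_norm_bounded h3.hasSum fun n => ?_
  rw [norm_genDirichletTerm (hlam.pos n) (ha n)]
  exact mul_le_mul_of_nonneg_left
    (Real.rpow_le_rpow_of_exponent_le (hlam.one_le' n) (by linarith)) (ha n)

/-- `(s - α)^m F(s)` extends analytically over the pole. -/
lemma IsContinuationWithPole.exists_regularization
    (h : IsContinuationWithPole α δ m lam a F) :
    ∃ G : ℂ → ℂ, AnalyticOnNhd ℂ G {s | α - δ ≤ s.re} ∧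
      ∀ s, s ≠ (α : ℂ) → G s = (s - α) ^ m * F s := by
  obtain ⟨g, hg, -, hgF⟩ := (meromorphicOrderAt_eq_int_iff h.meromorphicAt).mp h.order_eq
  refine ⟨Function.update (fun s => (s - α) ^ m * F s) α (g α), fun s hs => ?_, fun s hs => ?_⟩
  · by_cases hsα : s = α
    · subst hsα
      refine hg.congr ?_
      rw [eventually_nhdsWithin_iff] at hgF
      filter_upwards [hgF] with z hz
      by_cases hzα : z = α
      · subst hzα; simp
      · have hne : z - (α : ℂ) ≠ 0 := sub_ne_zero.mpr hzα
        rw [Function.update_of_ne hzα, hz hzα, smul_eq_mul, ← mul_assoc, zpow_neg, zpow_natCast,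
          mul_inv_cancel₀ (pow_ne_zero _ hne), one_mul]
    · have h1 : AnalyticAt ℂ (fun s : ℂ => (s - α) ^ m * F s) s :=
        ((analyticAt_id.sub analyticAt_const).pow m).mul (h.analytic s ⟨hs, hsα⟩)
      refine h1.congr ?_
      filter_upwards [isOpen_ne.mem_nhds hsα] with z hz
      rw [Function.update_of_ne hz]
  · rw [Function.update_of_ne hs]

/-- On the real segment, `(σ - α)^m F(σ)` is bounded by compactness. Non-negative coefficients give
`|F(s)| ≤ |F(Re s)|`, which carries the bound to complex `s`, at the price of `(Re s - α)^{-m}`,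
singular along the whole line `Re s = α`. -/
lemma IsContinuationWithPole.exists_norm_regularization_le (hδ : 0 < δ) (hm : 1 ≤ m)
    (hlam : IsFrequencySeq lam) (ha : ∀ n, 0 ≤ a n) (h : IsContinuationWithPole α δ m lam a F)
    {G : ℂ → ℂ} (hG : AnalyticOnNhd ℂ G {s | α - δ ≤ s.re})
    (hGF : ∀ s, s ≠ (α : ℂ) → G s = (s - α) ^ m * F s) :
    ∃ M : ℝ, 0 ≤ M ∧ ∀ s : ℂ, α ≤ s.re → s.re ≤ α + 2 →
      (s.re - α) ^ m * ‖G s‖ ≤ M * ‖s - α‖ ^ m := by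
  have hcont : ContinuousOn (fun x : ℝ => G x) (Set.Icc α (α + 2)) := by
    refine hG.continuousOn.comp Complex.continuous_ofReal.continuousOn fun x hx => ?_
    show α - δ ≤ (x : ℂ).re
    rw [Complex.ofReal_re]; linarith [hx.1]
  obtain ⟨M, hM⟩ := isCompact_Icc.exists_bound_of_continuousOn hcont
  refine ⟨M, (norm_nonneg _).trans (hM α ⟨le_rfl, by linarith⟩), fun s hs1 hs2 => ?_⟩
  have hM0 : 0 ≤ M := (norm_nonneg _).trans (hM α ⟨le_rfl, by linarith⟩)
  rcases hs1.eq_or_lt with heq | hlt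
  · rw [← heq, sub_self, zero_pow (by omega), zero_mul]; positivity
  · have hne : ∀ z : ℂ, α < z.re → z ≠ α := by rintro z hz rfl; simp at hz
    have h1 := hM s.re ⟨hs1, hs2⟩
    rw [hGF _ (hne _ (by simpa using hlt)), norm_mul, norm_pow, ← Complex.ofReal_sub,
      Complex.norm_real, Real.norm_of_nonneg (by linarith)] at h1
    rw [hGF s (hne s hlt), norm_mul, norm_pow]
    have h2 := h.norm_le_norm_ofReal hδ hlam ha hlt le_rfl
    have h3 : 0 ≤ (s.re - α) ^ m := pow_nonneg (by linarith) _
    calc (s.re - α) ^ m * (‖s - α‖ ^ m * ‖F s‖)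
        = ((s.re - α) ^ m * ‖F s‖) * ‖s - α‖ ^ m := by ring
      _ ≤ ((s.re - α) ^ m * ‖F s.re‖) * ‖s - α‖ ^ m := by gcongr
      _ ≤ M * ‖s - α‖ ^ m := by gcongr

/-- Bounds on the left edge of a strip and the bound `(Re s - α)^{-m}` inside propagate to the
closed strip, by the maximum principle on a rectangle. -/
lemma norm_le_of_maximum_principle_rect {G : ℂ → ℂ} {M Q Lft T : ℝ} (hM : 0 ≤ M) (hL : 0 ≤ Lft)
    (hQ : 0 ≤ Q) (hG : DifferentiableOn ℂ G {s | α ≤ s.re})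
    (hGM : ∀ s : ℂ, α ≤ s.re → s.re ≤ α + 2 → (s.re - α) ^ m * ‖G s‖ ≤ M * ‖s - α‖ ^ m)
    (hleft : ∀ s : ℂ, s.re = α → |s.im - T| ≤ 1 → ‖G s‖ ≤ Lft)
    (hdist : ∀ s : ℂ, α ≤ s.re → s.re ≤ α + 2 → |s.im - T| ≤ 1 → ‖s - α‖ ≤ Q)
    {s : ℂ} (hs1 : α ≤ s.re) (hs2 : s.re ≤ α + 2) (hsT : s.im = T) :
    ‖G s‖ ≤ 16 ^ m * (Lft + M * Q ^ m) := by
  set p₁ : ℂ := ⟨α, T + 1⟩ with hp₁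
  set p₂ : ℂ := ⟨α, T - 1⟩ with hp₂
  set U : Set ℂ := Set.Ioo α (α + 2) ×ℂ Set.Ioo (T - 1) (T + 1) with hU
  -- On a horizontal side one of the factors has modulus `(Re z - α)^m`, which cancels the blow-up
  -- at the corner. On `Im z = T` both factors have modulus at least `1` and can be dropped; on the
  -- rectangle `|z - pᵢ| ≤ 4`, whence `16 ^ m`.
  set H : ℂ → ℂ := fun z => (z - p₁) ^ m * (z - p₂) ^ m * G z with hH
  have hcl : closure U = Set.Icc α (α + 2) ×ℂ Set.Icc (T - 1) (T + 1) := by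
    rw [hU, Complex.closure_reProdIm, closure_Ioo (by linarith), closure_Ioo (by linarith)]
  have hn : ∀ z ∈ closure U, ‖z - p₁‖ ≤ 4 ∧ ‖z - p₂‖ ≤ 4 := by
    intro z hz
    rw [hcl, Complex.mem_reProdIm] at hz
    obtain ⟨⟨h1, h2⟩, h3, h4⟩ := hz
    constructor
    · refine (Complex.norm_le_abs_re_add_abs_im _).trans ?_
      simp only [Complex.sub_re, Complex.sub_im, hp₁]
      rw [abs_of_nonneg (by linarith), abs_of_nonpos (by linarith)]; linarith
    · refine (Complex.norm_le_abs_re_add_abs_im _).trans ?_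
      simp only [Complex.sub_re, Complex.sub_im, hp₂]
      rw [abs_of_nonneg (by linarith), abs_of_nonneg (by linarith)]; linarith
  have hfr : ∀ z ∈ frontier U, ‖H z‖ ≤ 16 ^ m * (Lft + M * Q ^ m) := by
    intro z hz
    have hzc := frontier_subset_closure hz
    obtain ⟨hz1, hz2⟩ := hn z hzc
    have hzc' := hzc
    rw [hcl, Complex.mem_reProdIm] at hzc'
    obtain ⟨⟨h1, h2⟩, h3, h4⟩ := hzc'
    have hT : |z.im - T| ≤ 1 := abs_le.mpr ⟨by linarith, by linarith⟩
    have hMQ : M * ‖z - α‖ ^ m ≤ M * Q ^ m := by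
      gcongr; exact hdist z h1 h2 hT
    have hMz := (hGM z h1 h2).trans hMQ
    have e16 : (16 : ℝ) ^ m = 4 ^ m * 4 ^ m := by rw [← mul_pow]; norm_num
    have hMQ0 : 0 ≤ M * Q ^ m := by positivity
    have hp1 : ‖z - p₁‖ ^ m ≤ 4 ^ m := by gcongr
    have hp2 : ‖z - p₂‖ ^ m ≤ 4 ^ m := by gcongr
    have hone : (1 : ℝ) ≤ 4 ^ m := one_le_pow₀ (by norm_num)
    have hfin : ∀ X : ℝ, ‖G z‖ ≤ X → X ≤ Lft + M * Q ^ m →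
        ‖z - p₁‖ ^ m * ‖z - p₂‖ ^ m * ‖G z‖ ≤ 16 ^ m * (Lft + M * Q ^ m) := by
      intro X h5 h6
      rw [e16]; gcongr; exact h5.trans h6
    have hhor : ∀ x y : ℝ, 0 ≤ x → x = z.re - α → 0 ≤ y → y ≤ 4 ^ m →
        x ^ m * y * ‖G z‖ ≤ 16 ^ m * (Lft + M * Q ^ m) := by
      intro x y hx hxe hy hy4
      calc x ^ m * y * ‖G z‖ = ((z.re - α) ^ m * ‖G z‖) * y := by rw [hxe]; ring
        _ ≤ (M * Q ^ m) * 4 ^ m := by gcongr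
        _ ≤ 16 ^ m * (Lft + M * Q ^ m) := by
          rw [e16]
          nlinarith [mul_le_mul_of_nonneg_right hone (by positivity : 0 ≤ (4 : ℝ) ^ m * (M * Q ^ m)),
            mul_nonneg (mul_nonneg (zero_le_one.trans hone) (zero_le_one.trans hone)) hL]
    simp only [hH, norm_mul, norm_pow]
    rw [hU, Complex.frontier_reProdIm, closure_Ioo (by linarith), closure_Ioo (by linarith),
      frontier_Ioo (by linarith), frontier_Ioo (by linarith)] at hz
    rcases hz with ⟨-, hz⟩ | ⟨hz, -⟩
    · have hz' : z.im = T - 1 ∨ z.im = T + 1 := hz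
      rcases hz' with hz' | hz'
      · have hx : ‖z - p₂‖ = z.re - α := by
          have : z - p₂ = ((z.re - α : ℝ) : ℂ) := by
            apply Complex.ext <;> simp [hp₂, hz']
          rw [this, Complex.norm_real, Real.norm_of_nonneg (by linarith)]
        have := hhor _ _ (norm_nonneg (z - p₂)) hx (by positivity) hp1
        linarith [mul_comm (‖z - p₁‖ ^ m) (‖z - p₂‖ ^ m) ▸ this]
      · have hx : ‖z - p₁‖ = z.re - α := by
          have : z - p₁ = ((z.re - α : ℝ) : ℂ) := by
            apply Complex.ext <;> simp [hp₁, hz']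
          rw [this, Complex.norm_real, Real.norm_of_nonneg (by linarith)]
        exact hhor _ _ (norm_nonneg _) hx (by positivity) hp2
    · have hz' : z.re = α ∨ z.re = α + 2 := hz
      rcases hz' with hz' | hz'
      · exact hfin _ (hleft z hz' hT) (by linarith)
      · refine hfin _ ?_ (show M * Q ^ m ≤ _ by linarith)
        rw [hz', add_sub_cancel_left] at hMz
        have : (1 : ℝ) ≤ 2 ^ m := one_le_pow₀ (by norm_num)
        nlinarith [norm_nonneg (G z)]
  have hHd : DiffContOnCl ℂ H U := by
    refine DifferentiableOn.diffContOnCl ?_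
    refine ((by fun_prop : Differentiable ℂ fun z => (z - p₁) ^ m * (z - p₂) ^ m).differentiableOn).mul
      (hG.mono fun z hz => ?_)
    rw [hcl, Complex.mem_reProdIm] at hz
    exact hz.1.1
  have hbd : Bornology.IsBounded U :=
    (Metric.isBounded_Ioo _ _).reProdIm (Metric.isBounded_Ioo _ _)
  have hmem : s ∈ closure U := by
    rw [hcl, Complex.mem_reProdIm]
    exact ⟨⟨hs1, hs2⟩, by rw [hsT]; constructor <;> linarith⟩
  have hfinal := Complex.norm_le_of_forall_mem_frontier_norm_le hbd hHd hfr hmem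
  refine le_trans ?_ hfinal
  simp only [hH, norm_mul, norm_pow]
  have h1 : 1 ≤ ‖s - p₁‖ := by
    refine le_trans ?_ (Complex.abs_im_le_norm _)
    simp [hp₁, hsT]
  have h2 : 1 ≤ ‖s - p₂‖ := by
    refine le_trans ?_ (Complex.abs_im_le_norm _)
    simp [hp₂, hsT]
  exact le_mul_of_one_le_left (norm_nonneg _)
    (one_le_mul_of_one_le_of_one_le (one_le_pow₀ h1) (one_le_pow₀ h2))

end Continuation

end Growth

/-! ### Uniform polynomial growth in the strip. -/

/-- The data of `HypothesisB` for a given continuation `F`. -/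
structure IsHypothesisBContinuation (α δ κ : ℝ) (m : ℕ) (C : ℝ) (lam a : ℕ+ → ℝ) (F : ℂ → ℂ) :
    Prop where
  frequency : IsFrequencySeq lam
  nonneg : ∀ n, 0 ≤ a n
  cont : IsContinuationWithPole α δ m lam a F
  growth : ∃ M₁ M₂ : ℝ, 0 ≤ M₁ ∧ 0 ≤ M₂ ∧ ∀ s : ℂ, α - δ ≤ s.re → s.re ≤ α → s ≠ (α : ℂ) →
      ‖(s - (α : ℂ)) ^ m * F s‖ ≤ M₁ * Real.exp (‖s‖ ^ M₂)
  edge : ∀ s : ℂ, s.re = α - δ →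
      ‖F s‖ ≤ C * (1 + |s.im|) ^ κ * (Real.log (3 + |s.im|)) ^ (m - 1)

lemma HypothesisB.exists_continuation {α δ κ C : ℝ} {m : ℕ} {lam a : ℕ+ → ℝ}
    (h : HypothesisB α δ κ m C lam a) : ∃ F, IsHypothesisBContinuation α δ κ m C lam a F := by
  obtain ⟨F, h1, h2, h3⟩ := h.continuation
  exact ⟨F, h.frequency, h.nonneg, h1, h2, h3⟩

section Uniform

variable {α δ κ C : ℝ} {m : ℕ} {lam a : ℕ+ → ℝ} {F G : ℂ → ℂ}

/-- The growth hypothesis stops at `Re s = α`; the maximum principle carries it to `Re s ≤ α + 2`.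
The constants may depend on the series, since they serve only to make Phragmén–Lindelöf applicable.
-/
lemma IsHypothesisBContinuation.exists_finite_order (hδ : 0 < δ) (hδα : δ < α) (hm : 1 ≤ m)
    (h : IsHypothesisBContinuation α δ κ m C lam a F)
    (hG : AnalyticOnNhd ℂ G {s | α - δ ≤ s.re})
    (hGF : ∀ s, s ≠ (α : ℂ) → G s = (s - α) ^ m * F s) :
    ∃ B q M : ℝ, ∀ s : ℂ, α - δ ≤ s.re → s.re ≤ α + 2 →
      ‖G s‖ ≤ B * Real.exp ((|s.im| + q) ^ M) := by
  obtain ⟨M₁, M₂, hM₁, hM₂, hgr⟩ := h.growth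
  obtain ⟨M₀, hM₀, hGM⟩ :=
    h.cont.exists_norm_regularization_le hδ hm h.frequency h.nonneg hG hGF
  set L : ℝ := max M₁ ‖G α‖ with hL
  have hL0 : 0 ≤ L := hM₁.trans (le_max_left _ _)
  -- The shift leaves room for rectangles reaching height `|Im s| + 1`. The exponent `M` is at least
  -- `1` so that `exp ((|Im s| + q) ^ M)` also absorbs the polynomial factor, through `x ^ m ≤ m!
  -- exp x`.
  set q : ℝ := α + 4 with hq
  set M : ℝ := max M₂ 1 with hM
  have hexp : ∀ x y : ℝ, 0 ≤ x → x ≤ |y| + q →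
      Real.exp (x ^ M₂) ≤ Real.exp ((|y| + q) ^ M) := by
    intro x y hx hxy
    have hy := abs_nonneg y
    refine Real.exp_le_exp.mpr ((Real.rpow_le_rpow hx hxy hM₂).trans ?_)
    exact Real.rpow_le_rpow_of_exponent_le (by linarith) (le_max_left _ _)
  have hleft : ∀ s : ℂ, α - δ ≤ s.re → s.re ≤ α → ‖G s‖ ≤ L * Real.exp (‖s‖ ^ M₂) := by
    intro s h1 h2
    by_cases hs : s = α
    · subst hs
      have : 1 ≤ Real.exp (‖(α : ℂ)‖ ^ M₂) := Real.one_le_exp (by positivity)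
      exact (le_max_right M₁ _).trans (le_mul_of_one_le_right hL0 this)
    · rw [hGF s hs]
      exact (hgr s h1 h2 hs).trans (by gcongr; exact le_max_left _ _)
  have hnorm : ∀ s : ℂ, α - δ ≤ s.re → s.re ≤ α → ‖s‖ ≤ |s.im| + α := by
    intro s h1 h2
    have := Complex.norm_le_abs_re_add_abs_im s
    rw [abs_of_nonneg (by linarith : 0 ≤ s.re)] at this
    linarith
  refine ⟨16 ^ m * (L + M₀ * m.factorial), q, M, fun s h1 h2 => ?_⟩
  have h16 : (1 : ℝ) ≤ 16 ^ m := one_le_pow₀ (by norm_num)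
  have hMf : 0 ≤ M₀ * m.factorial := by positivity
  rcases le_total s.re α with h3 | h3
  · refine (hleft s h1 h3).trans ?_
    have e1 := hexp ‖s‖ s.im (norm_nonneg _) (by have := hnorm s h1 h3; linarith)
    refine mul_le_mul ?_ e1 (Real.exp_pos _).le (by positivity)
    nlinarith
  · have key := norm_le_of_maximum_principle_rect (α := α) (m := m) (G := G) (M := M₀)
      (Q := |s.im| + q) (Lft := L * Real.exp ((|s.im| + q) ^ M)) (T := s.im) hM₀ (by positivity)
      (by have := abs_nonneg s.im; linarith)
      (hG.differentiableOn.mono fun z hz => by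
        have hz' : α ≤ z.re := hz
        show α - δ ≤ z.re
        linarith) hGM
      (fun z hz1 hz2 => by
        refine (hleft z (by linarith) hz1.le).trans ?_
        refine mul_le_mul_of_nonneg_left (hexp _ _ (norm_nonneg _) ?_) hL0
        have := hnorm z (by linarith) hz1.le
        have := abs_sub_abs_le_abs_sub z.im s.im
        linarith)
      (fun z hz1 hz2 hz3 => by
        refine (Complex.norm_le_abs_re_add_abs_im _).trans ?_
        simp only [Complex.sub_re, Complex.sub_im, Complex.ofReal_re, Complex.ofReal_im, sub_zero]
        rw [abs_of_nonneg (by linarith : 0 ≤ z.re - α)]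
        have := abs_sub_abs_le_abs_sub z.im s.im
        linarith) h3 h2 rfl
    refine key.trans ?_
    rw [mul_assoc]
    refine mul_le_mul_of_nonneg_left ?_ (by positivity)
    rw [add_mul]
    refine add_le_add_right ?_ _
    rw [mul_assoc]
    refine mul_le_mul_of_nonneg_left ?_ hM₀
    have hb : 1 ≤ |s.im| + q := by have := abs_nonneg s.im; linarith
    have e2 := Real.pow_div_factorial_le_exp (|s.im| + q) (by linarith) m
    rw [div_le_iff₀ (by positivity), mul_comm] at e2
    refine e2.trans (mul_le_mul_of_nonneg_left (Real.exp_le_exp.mpr ?_) (by positivity))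
    exact Real.self_le_rpow_of_one_le hb (le_max_right _ _)

/-- On the left edge, `(s - α)^m F(s)` has polynomial growth with a uniform constant. -/
lemma IsHypothesisBContinuation.norm_left_le (hδ : 0 < δ) (hm : 1 ≤ m) (hC : 0 ≤ C) (hκ : 0 ≤ κ)
    (h : IsHypothesisBContinuation α δ κ m C lam a F) {s : ℂ} (hs : s.re = α - δ) :
    ‖s - α‖ ^ m * ‖F s‖ ≤ ((1 + δ) ^ m * C * 2 ^ ⌈κ⌉₊ * 3 ^ m) *
      ‖s - ((α - δ - 1 : ℝ) : ℂ)‖ ^ (m + ⌈κ⌉₊ + m) := by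
  set R := ‖s - ((α - δ - 1 : ℝ) : ℂ)‖ with hR
  have hRre : 1 ≤ R := by
    refine le_trans ?_ (Complex.abs_re_le_norm _)
    simp [hs]
  have hRim : |s.im| ≤ R := by
    refine le_trans ?_ (Complex.abs_im_le_norm _)
    simp
  have h1 : ‖s - α‖ ≤ (1 + δ) * R := by
    refine (Complex.norm_le_abs_re_add_abs_im _).trans ?_
    simp only [Complex.sub_re, Complex.sub_im, Complex.ofReal_re, Complex.ofReal_im, sub_zero, hs]
    rw [show α - δ - α = -δ by ring, abs_neg, abs_of_pos hδ]
    nlinarith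
  have h2 : (1 + |s.im|) ^ κ ≤ (2 * R) ^ ⌈κ⌉₊ := by
    have := abs_nonneg s.im
    rw [← Real.rpow_natCast]
    exact (Real.rpow_le_rpow (by positivity) (by linarith) hκ).trans
      (Real.rpow_le_rpow_of_exponent_le (by linarith) (Nat.le_ceil κ))
  have h3 : Real.log (3 + |s.im|) ^ (m - 1) ≤ (3 * R) ^ m := by
    have h0 := abs_nonneg s.im
    have hl0 : 0 ≤ Real.log (3 + |s.im|) := Real.log_nonneg (by linarith)
    have := Real.log_le_sub_one_of_pos (by linarith : 0 < 3 + |s.im|)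
    calc Real.log (3 + |s.im|) ^ (m - 1) ≤ (3 * R) ^ (m - 1) := by gcongr; linarith
      _ ≤ (3 * R) ^ m := pow_le_pow_right₀ (by linarith) (by omega)
  have h4 := h.edge s hs
  have hl0 : 0 ≤ Real.log (3 + |s.im|) := Real.log_nonneg (by linarith [abs_nonneg s.im])
  calc ‖s - α‖ ^ m * ‖F s‖
      ≤ ((1 + δ) * R) ^ m * (C * (2 * R) ^ ⌈κ⌉₊ * (3 * R) ^ m) := by
        gcongr
        exact h4.trans (by gcongr)
    _ = _ := by rw [mul_pow, mul_pow, mul_pow, pow_add, pow_add]; ring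

/-- Uniform polynomial bound for `(s - α)^m F(s)` in the strip `α - δ ≤ Re s ≤ α + 1`. -/
theorem exists_uniform_strip_bound (α δ κ C : ℝ) (m : ℕ) (hδ : 0 < δ) (hδα : δ < α)
    (hκ : 0 ≤ κ) (hm : 1 ≤ m) (hC : 1 ≤ C) :
    ∃ K : ℝ, 0 < K ∧ ∀ (lam a : ℕ+ → ℝ) (F : ℂ → ℂ),
      IsHypothesisBContinuation α δ κ m C lam a F → ∀ s : ℂ, s ≠ α → α - δ ≤ s.re →
        s.re ≤ α + 1 → ‖s - α‖ ^ m * ‖F s‖ ≤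
          K * ‖s - ((α - δ - 1 : ℝ) : ℂ)‖ ^ (m + ⌈κ⌉₊ + m) := by
  -- One `m` is for `(s - α)^m`, `⌈κ⌉₊` for the growth on the left edge, the other `m` for the power
  -- of the logarithm.
  set N := m + ⌈κ⌉₊ + m with hN
  set B : ℝ := (1 + δ) ^ m * C * 2 ^ ⌈κ⌉₊ * 3 ^ m with hB
  have hB0 : 0 < B := by positivity
  -- `D` is the weight `‖s - β‖ ^ N` at `s = α + 1`. The tilt `η` satisfies `exp (-η) = 1 / (2D)`,
  -- which makes the right-edge term half of the value at `α + 1`.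
  set D : ℝ := (δ + 2) ^ N with hD
  have hD1 : 1 ≤ D := one_le_pow₀ (by linarith)
  set η : ℝ := Real.log (2 * D) with hη
  have hη0 : 0 ≤ η := Real.log_nonneg (by linarith)
  have hηe : Real.exp η = 2 * D := Real.exp_log (by linarith)
  set K : ℝ := D * (B * Real.exp (η * (δ + 1))) with hK
  have hBE : B ≤ B * Real.exp (η * (δ + 1)) :=
    le_mul_of_one_le_right hB0.le (Real.one_le_exp (by positivity))
  have hBK : B ≤ K := hBE.trans (le_mul_of_one_le_left (by positivity) hD1)
  refine ⟨K, by positivity, fun lam a F h => ?_⟩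
  obtain ⟨G, hG, hGF⟩ := h.cont.exists_regularization
  obtain ⟨B', q, M, hfin⟩ := h.exists_finite_order hδ hδα hm hG hGF
  set β : ℂ := ((α - δ - 1 : ℝ) : ℂ) with hβ
  have hne : ∀ s : ℂ, s.re ≠ α → s ≠ α := by rintro s hs rfl; simp at hs
  have hGn : ∀ s : ℂ, s ≠ α → ‖G s‖ = ‖s - α‖ ^ m * ‖F s‖ := by
    intro s hs; rw [hGF s hs, norm_mul, norm_pow]
  have hR1 : ∀ s : ℂ, α - δ ≤ s.re → 1 ≤ ‖s - β‖ := by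
    intro s hs
    refine le_trans ?_ (Complex.re_le_norm _)
    simp only [hβ, Complex.sub_re, Complex.ofReal_re]; linarith
  have hleft : ∀ s : ℂ, s.re = α - δ → ‖G s‖ / ‖s - β‖ ^ N ≤ B := by
    intro s hs
    have := hR1 s hs.ge
    rw [div_le_iff₀ (by positivity), hGn s (hne s (by rw [hs]; linarith))]
    exact h.norm_left_le hδ hm (by linarith) hκ hs
  have hright : ∀ s : ℂ, s.re = α + 2 → ‖G s‖ / ‖s - β‖ ^ N ≤ ‖F ((α + 1 : ℝ) : ℂ)‖ := by
    intro s hs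
    have h1 := hR1 s (by linarith)
    rw [div_le_iff₀ (by positivity), hGn s (hne s (by rw [hs]; linarith)), mul_comm]
    have h2 := h.cont.norm_le_norm_ofReal hδ h.frequency h.nonneg (σ := α + 1) (s := s)
      (by linarith) (by linarith)
    have h3 : ‖s - α‖ ≤ ‖s - β‖ := by
      rw [Complex.norm_def, Complex.norm_def]
      refine Real.sqrt_le_sqrt ?_
      rw [Complex.normSq_apply, Complex.normSq_apply]
      simp only [hβ, Complex.sub_re, Complex.sub_im, Complex.ofReal_re, Complex.ofReal_im, hs]
      nlinarith
    refine mul_le_mul h2 ?_ (by positivity) (norm_nonneg _)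
    calc ‖s - α‖ ^ m ≤ ‖s - β‖ ^ m := by gcongr
      _ ≤ ‖s - β‖ ^ N := pow_le_pow_right₀ h1 (by omega)
  -- The tilt `exp (-ξ(s - α - 1))` lowers the right edge by `exp (-ξ)`, raises the left edge by a
  -- fixed factor, and equals `1` at `α + 1`.
  have hPL : ∀ ξ X : ℝ, 0 ≤ ξ → B * Real.exp (ξ * (δ + 1)) ≤ X →
      ‖F ((α + 1 : ℝ) : ℂ)‖ * Real.exp (-ξ) ≤ X → ∀ s : ℂ, α - δ ≤ s.re → s.re ≤ α + 2 →
      ‖G s‖ / ‖s - β‖ ^ N * Real.exp (-ξ * (s.re - (α + 1))) ≤ X := by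
    intro ξ X hξ hX1 hX2 s hs1 hs2
    set f : ℂ → ℂ := fun z => G z / (z - β) ^ N * Complex.exp (-ξ * (z - ((α + 1 : ℝ) : ℂ))) with hf
    have hfn : ∀ z : ℂ, ‖f z‖ = ‖G z‖ / ‖z - β‖ ^ N * Real.exp (-ξ * (z.re - (α + 1))) := by
      intro z
      simp only [hf, norm_mul, norm_div, norm_pow, Complex.norm_exp]
      congr 2
      rw [← Complex.ofReal_neg, Complex.re_ofReal_mul, Complex.sub_re, Complex.ofReal_re]
    rw [← hfn]
    refine norm_le_of_finite_order_vertical_strip (a := α - δ) (b := α + 2)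
      (B := B' * Real.exp (ξ * (δ + 1))) (q := q) (M := M) (by linarith) ?_ ?_ ?_ ?_ hs1 hs2
    · refine (hG.differentiableOn.div (by fun_prop) fun z hz => ?_).mul (by fun_prop)
      have := hR1 z hz
      exact pow_ne_zero _ (norm_pos_iff.mp (by linarith))
    · intro z hz1 hz2
      rw [hfn]
      have h1 := hR1 z hz1.le
      have h2 := hfin z hz1.le hz2.le
      calc ‖G z‖ / ‖z - β‖ ^ N * Real.exp (-ξ * (z.re - (α + 1)))
          ≤ ‖G z‖ * Real.exp (ξ * (δ + 1)) := by
            refine mul_le_mul (div_le_self (norm_nonneg _) (one_le_pow₀ h1))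
              (Real.exp_le_exp.mpr ?_) (Real.exp_pos _).le (norm_nonneg _)
            nlinarith
        _ ≤ (B' * Real.exp ((|z.im| + q) ^ M)) * Real.exp (ξ * (δ + 1)) := by gcongr
        _ = _ := by ring
    · intro z hz
      rw [hfn, hz, show -ξ * (α - δ - (α + 1)) = ξ * (δ + 1) by ring]
      exact (mul_le_mul_of_nonneg_right (hleft z hz) (Real.exp_pos _).le).trans hX1
    · intro z hz
      rw [hfn, hz, show -ξ * (α + 2 - (α + 1)) = -ξ by ring]
      exact (mul_le_mul_of_nonneg_right (hright z hz) (Real.exp_pos _).le).trans hX2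
  -- With `A = ‖F(α + 1)‖`, the tilted bound reads `A / D ≤ max (B exp (η(δ + 1))) (A / (2D))`; the
  -- second alternative forces `A ≤ 0`.
  have hA : ‖F ((α + 1 : ℝ) : ℂ)‖ ≤ K := by
    set A := ‖F ((α + 1 : ℝ) : ℂ)‖ with hA
    have hmid := hPL η (max (B * Real.exp (η * (δ + 1))) (A * Real.exp (-η))) hη0
      (le_max_left _ _) (le_max_right _ _) ((α + 1 : ℝ) : ℂ)
      (by rw [Complex.ofReal_re]; linarith) (by rw [Complex.ofReal_re]; linarith)
    have e1 : ‖((α + 1 : ℝ) : ℂ) - β‖ = δ + 2 := by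
      rw [hβ, ← Complex.ofReal_sub, Complex.norm_real, Real.norm_of_nonneg (by linarith)]; ring
    have e2 : ‖((α + 1 : ℝ) : ℂ) - α‖ = 1 := by
      rw [← Complex.ofReal_sub, Complex.norm_real, Real.norm_of_nonneg (by linarith)]; ring
    rw [hGn _ (hne _ (by rw [Complex.ofReal_re]; linarith)), e1, e2, one_pow, one_mul,
      Complex.ofReal_re, sub_self, mul_zero, Real.exp_zero, mul_one, ← hA] at hmid
    rcases le_max_iff.mp hmid with h1 | h1
    · rw [div_le_iff₀ (by positivity)] at h1
      rw [hK]; linarith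
    · rw [Real.exp_neg, hηe, ← div_eq_mul_inv, div_le_div_iff₀ (by positivity) (by positivity)] at h1
      have : A ≤ 0 := by nlinarith
      exact this.trans (by positivity)
  intro s hs hs1 hs2
  -- Without tilt: the right edge is now bounded by the uniform `K`.
  have hfinal := hPL 0 K le_rfl (by simpa using hBK) (by simpa using hA) s hs1 (by linarith)
  have h1 := hR1 s hs1
  rw [neg_zero, zero_mul, Real.exp_zero, mul_one, div_le_iff₀ (by positivity), hGn s hs] at hfinal
  exact hfinal

end Uniform

/-! ### Gaussian smoothing and positivity. -/

section Smoothing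

open MeasureTheory intervalIntegral

/-- The kernel `exp (h² w² / 2 + w y)`. -/
noncomputable def gaussKernel (h y : ℝ) (w : ℂ) : ℂ :=
  Complex.exp ((h ^ 2 / 2 : ℝ) * w ^ 2 + w * y)

lemma differentiable_gaussKernel (h y : ℝ) : Differentiable ℂ (gaussKernel h y) := by
  unfold gaussKernel; fun_prop

lemma norm_gaussKernel (h y : ℝ) (w : ℂ) :
    ‖gaussKernel h y w‖ = Real.exp (h ^ 2 / 2 * (w.re ^ 2 - w.im ^ 2) + w.re * y) := by
  rw [gaussKernel, Complex.norm_exp, Complex.add_re, Complex.re_ofReal_mul, Complex.re_mul_ofReal]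
  congr 3
  rw [sq, Complex.mul_re]; ring

lemma integrable_gaussKernel {h : ℝ} (hh : 0 < h) (y x : ℝ) :
    Integrable fun t : ℝ => gaussKernel h y (x + t * Complex.I) := by
  have hb : 0 < ((h ^ 2 / 2 : ℝ) : ℂ).re := by rw [Complex.ofReal_re]; positivity
  refine (integrable_cexp_quadratic hb ((h ^ 2 * x + y : ℝ) * Complex.I)
    ((h ^ 2 / 2 * x ^ 2 + x * y : ℝ))).congr (ae_of_all _ fun t => ?_)
  simp only [gaussKernel]
  congr 1
  push_cast
  linear_combination (-(h : ℂ) ^ 2 / 2 * t ^ 2) * Complex.I_sq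

lemma integral_gaussKernel {h : ℝ} (hh : 0 < h) (y x : ℝ) :
    ∫ t : ℝ, gaussKernel h y (x + t * Complex.I) =
      (((2 * Real.pi / h ^ 2) ^ (1 / 2 : ℝ) * Real.exp (-(y ^ 2 / (2 * h ^ 2))) : ℝ) : ℂ) := by
  have hb : (-(h ^ 2 / 2 : ℝ) : ℂ).re < 0 := by
    rw [← Complex.ofReal_neg, Complex.ofReal_re]; simp; positivity
  have hint := integral_cexp_quadratic hb ((h ^ 2 * x + y : ℝ) * Complex.I)
    ((h ^ 2 / 2 * x ^ 2 + x * y : ℝ))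
  have hh' : (h : ℂ) ≠ 0 := by exact_mod_cast hh.ne'
  calc ∫ t : ℝ, gaussKernel h y (x + t * Complex.I) = _ := by
        refine integral_congr_ae (ae_of_all _ fun t => ?_)
        simp only [gaussKernel]
        show _ = Complex.exp (-(h ^ 2 / 2 : ℝ) * (t : ℂ) ^ 2 + (h ^ 2 * x + y : ℝ) * Complex.I * t +
          (h ^ 2 / 2 * x ^ 2 + x * y : ℝ))
        congr 1
        push_cast
        linear_combination ((h : ℂ) ^ 2 / 2 * t ^ 2) * Complex.I_sq
    _ = _ := hint
    _ = _ := by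
        rw [Complex.ofReal_mul, Complex.ofReal_cpow (by positivity), Complex.ofReal_exp]
        congr 2
        · push_cast; field_simp
        · push_cast; norm_num
        · push_cast
          field_simp
          linear_combination (4 * ((h : ℂ) ^ 2 * x + y) ^ 2) * Complex.I_sq

/-- The factor `λₙ^{-w} = exp (-w log λₙ)` only translates the parameter `y` of the kernel, so each
term integrates to an explicit Gaussian. -/
lemma genDirichletTerm_mul_gaussKernel {lam a : ℕ+ → ℝ} {n : ℕ+} (hl : 0 < lam n) (α h y : ℝ)
    (w : ℂ) :
    genDirichletTerm lam a (α + w) n * gaussKernel h y w =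
      ((a n * lam n ^ (-α) : ℝ) : ℂ) * gaussKernel h (y - Real.log (lam n)) w := by
  have hl' : (lam n : ℂ) ≠ 0 := by exact_mod_cast hl.ne'
  rw [genDirichletTerm, neg_add, Complex.cpow_add _ _ hl', Complex.ofReal_mul,
    Complex.ofReal_cpow hl.le, Complex.ofReal_neg, Complex.cpow_def_of_ne_zero hl' (-w),
    ← Complex.ofReal_log hl.le, gaussKernel, gaussKernel, mul_assoc, mul_assoc, mul_assoc,
    ← Complex.exp_add]
  congr 3
  push_cast; ring

section Lower

variable {α δ κ C : ℝ} {m : ℕ} {lam a : ℕ+ → ℝ} {F : ℂ → ℂ}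

lemma IsContinuationWithPole.integrable_mul_gaussKernel (hδ : 0 < δ) (hlam : IsFrequencySeq lam)
    (ha : ∀ n, 0 ≤ a n) (hF : IsContinuationWithPole α δ m lam a F) {h : ℝ} (hh : 0 < h) (y : ℝ) :
    Integrable fun t : ℝ => F (α + (1 + t * Complex.I)) * gaussKernel h y (1 + t * Complex.I) := by
  have hre : ∀ t : ℝ, ((α : ℂ) + (1 + t * Complex.I)).re = α + 1 := by intro t; simp
  have hg := integrable_gaussKernel hh y 1
  rw [Complex.ofReal_one] at hg
  refine hg.bdd_mul (c := ‖F ((α + 1 : ℝ) : ℂ)‖) ?_ (ae_of_all _ fun t => ?_)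
  · refine Continuous.aestronglyMeasurable ?_
    refine (hF.differentiableOn_re_gt hδ).continuousOn.comp_continuous (by fun_prop) fun t => ?_
    show α < ((α : ℂ) + (1 + t * Complex.I)).re
    rw [hre]; linarith
  · exact hF.norm_le_norm_ofReal hδ hlam ha (by linarith) (hre t).ge

/-- Positivity: a single coefficient is bounded by the smoothed sum. -/
lemma IsContinuationWithPole.coeff_le_norm_integral (hδ : 0 < δ) (hlam : IsFrequencySeq lam)
    (ha : ∀ n, 0 ≤ a n) (hF : IsContinuationWithPole α δ m lam a F) {h : ℝ} (hh : 0 < h) (n : ℕ+) :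
    a n * lam n ^ (-α) ≤ h * ‖∫ t : ℝ, F (α + (1 + t * Complex.I)) *
      gaussKernel h (Real.log (lam n)) (1 + t * Complex.I)‖ := by
  set y := Real.log (lam n) with hy
  have hre : ∀ t : ℝ, ((α : ℂ) + (1 + t * Complex.I)).re = α + 1 := by intro t; simp
  set f : ℕ+ → ℝ → ℂ := fun k t => genDirichletTerm lam a (α + (1 + t * Complex.I)) k *
    gaussKernel h y (1 + t * Complex.I) with hf
  have hfe : ∀ k, f k = fun t : ℝ => ((a k * lam k ^ (-α) : ℝ) : ℂ) *
      gaussKernel h (y - Real.log (lam k)) (((1 : ℝ) : ℂ) + t * Complex.I) := by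
    intro k; funext t
    rw [Complex.ofReal_one]
    exact genDirichletTerm_mul_gaussKernel (hlam.pos k) α h y _
  have hint : ∀ k, Integrable (f k) := by
    intro k; rw [hfe]; exact (integrable_gaussKernel hh _ 1).const_mul _
  have hnorm : ∀ k, ∫ t, ‖f k t‖ =
      (a k * lam k ^ (-(α + 1))) * ∫ t : ℝ, ‖gaussKernel h y (1 + t * Complex.I)‖ := by
    intro k
    rw [← MeasureTheory.integral_const_mul]
    refine integral_congr_ae (ae_of_all _ fun t => ?_)
    simp only [hf]
    rw [norm_mul, norm_genDirichletTerm (hlam.pos k) (ha k), hre]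
  have hsm : Summable fun k => a k * lam k ^ (-(α + 1)) := by
    have h2 := (hF.hasSum_of_re_gt hδ hlam ha (s := ((α + 1 : ℝ) : ℂ))
      (by rw [Complex.ofReal_re]; linarith)).summable
    exact Complex.summable_ofReal.mp
      (h2.congr fun k => genDirichletTerm_ofReal (hlam.pos k) (α + 1))
  -- Sum and integral may be exchanged because the norm integrals are `aₖ λₖ^{-(α+1)}` times a
  -- common factor.
  have hsum := hasSum_integral_of_summable_integral_norm hint
    (by simp_rw [hnorm]; exact hsm.mul_right _)
  have hval : ∀ k, ∫ t, f k t = ((a k * lam k ^ (-α) * ((2 * Real.pi / h ^ 2) ^ (1 / 2 : ℝ) *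
      Real.exp (-((y - Real.log (lam k)) ^ 2 / (2 * h ^ 2)))) : ℝ) : ℂ) := by
    intro k
    rw [hfe, MeasureTheory.integral_const_mul, integral_gaussKernel hh, ← Complex.ofReal_mul]
  have htsum : ∀ t : ℝ, ∑' k, f k t = F (α + (1 + t * Complex.I)) *
      gaussKernel h y (1 + t * Complex.I) := fun t =>
    ((hF.hasSum_of_re_gt hδ hlam ha (s := α + (1 + t * Complex.I))
      (by rw [hre]; linarith)).mul_right _).tsum_eq
  simp_rw [htsum, hval] at hsum
  have hsr : Summable fun k => a k * lam k ^ (-α) * ((2 * Real.pi / h ^ 2) ^ (1 / 2 : ℝ) *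
      Real.exp (-((y - Real.log (lam k)) ^ 2 / (2 * h ^ 2)))) :=
    Complex.summable_ofReal.mp hsum.summable
  rw [hsum.unique (Complex.hasSum_ofReal.mpr hsr.hasSum), Complex.norm_real]
  -- All terms are non-negative, so only `k = n` is kept; there the Gaussian is at its peak.
  have hle := hsr.le_tsum n fun k _ => by
    have := ha k
    have := (hlam.pos k).le
    positivity
  rw [← hy, sub_self, zero_pow two_ne_zero, zero_div, neg_zero, Real.exp_zero, mul_one] at hle
  have hcoef : h⁻¹ ≤ (2 * Real.pi / h ^ 2) ^ (1 / 2 : ℝ) := by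
    rw [← Real.sqrt_eq_rpow]
    refine Real.le_sqrt_of_sq_le ?_
    rw [inv_pow, ← one_div]
    gcongr
    linarith [Real.pi_gt_three]
  have h0 : 0 ≤ a n * lam n ^ (-α) := mul_nonneg (ha n) (Real.rpow_nonneg (hlam.pos n).le _)
  calc a n * lam n ^ (-α) = h * (a n * lam n ^ (-α) * h⁻¹) := by field_simp
    _ ≤ h * _ := mul_le_mul_of_nonneg_left
      (((mul_le_mul_of_nonneg_left hcoef h0).trans hle).trans (Real.le_norm_self _)) hh.le

end Lower

/-! ### Shifting the line of integration past the pole. -/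

section Contour

open Filter Topology

/-- Moving a vertical line of integration past a singularity at `α`, along the line
`Re s = b` indented by the three sides of a rectangle around `α`. -/
lemma norm_integral_vertical_le_of_indented {Φ : ℂ → ℂ} {α b c r Hb Mb : ℝ} {g k ε : ℝ → ℝ}
    (hb : b ≤ α) (hr : 0 < r) (hrc : α + r ≤ c)
    (hΦ : DifferentiableOn ℂ Φ ({s : ℂ | b ≤ s.re} \ {(α : ℂ)}))
    (hint : Integrable fun t : ℝ => Φ (c + t * Complex.I))
    (hg : Integrable g) (hg0 : ∀ t, 0 ≤ g t)
    (hleft : ∀ t : ℝ, r ≤ |t| → ‖Φ (b + t * Complex.I)‖ ≤ g t)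
    (hk : Continuous k) (hkH : ∫ x in b..(α + r), k x ≤ Hb)
    (hhor₁ : ∀ x : ℝ, b ≤ x → x ≤ α + r → ‖Φ (x + (r : ℝ) * Complex.I)‖ ≤ k x)
    (hhor₂ : ∀ x : ℝ, b ≤ x → x ≤ α + r → ‖Φ (x + (-r : ℝ) * Complex.I)‖ ≤ k x)
    (hmid : ∀ t : ℝ, |t| ≤ r → ‖Φ ((α + r : ℝ) + t * Complex.I)‖ ≤ Mb)
    (hε : Tendsto ε atTop (𝓝 0))
    (hfar : ∀ᶠ T : ℝ in atTop, ∀ x : ℝ, b ≤ x → x ≤ c →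
      ‖Φ (x + T * Complex.I)‖ ≤ ε T ∧ ‖Φ (x + (-T : ℝ) * Complex.I)‖ ≤ ε T) :
    ‖∫ t : ℝ, Φ (c + t * Complex.I)‖ ≤ (∫ t, g t) + 2 * Hb + 2 * r * Mb := by
  have hbc : b ≤ c := by linarith
  have hbp : b ≤ α + r := by linarith
  have hrect : ∀ x₁ x₂ y₁ y₂ : ℝ, b ≤ x₁ → x₁ ≤ x₂ → y₁ ≤ y₂ → (0 < y₁ ∨ y₂ < 0 ∨ α < x₁) →
      (∫ x : ℝ in x₁..x₂, Φ (x + y₁ * Complex.I)) - (∫ x : ℝ in x₁..x₂, Φ (x + y₂ * Complex.I)) +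
      Complex.I • (∫ y : ℝ in y₁..y₂, Φ (x₂ + y * Complex.I)) -
      Complex.I • (∫ y : ℝ in y₁..y₂, Φ (x₁ + y * Complex.I)) = 0 := by
    intro x₁ x₂ y₁ y₂ h1 h2 h3 h4
    have h := Complex.integral_boundary_rect_eq_zero_of_differentiableOn Φ ⟨x₁, y₁⟩ ⟨x₂, y₂⟩
      (hΦ.mono fun z hz => by
        rw [Complex.mem_reProdIm, Set.uIcc_of_le h2, Set.uIcc_of_le h3] at hz
        obtain ⟨⟨hz1, hz2⟩, hz3, hz4⟩ := hz
        refine ⟨h1.trans hz1, ?_⟩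
        rintro rfl
        simp only [Complex.ofReal_re, Complex.ofReal_im] at hz1 hz2 hz3 hz4
        rcases h4 with h4 | h4 | h4 <;> linarith)
    simpa using h
  have hcontv : ∀ x : ℝ, b ≤ x → α ≠ x → Continuous fun t : ℝ => Φ (x + t * Complex.I) := by
    intro x hx hxα
    refine hΦ.continuousOn.comp_continuous (by fun_prop) fun t => ⟨by simpa using hx, ?_⟩
    intro h
    have := congrArg Complex.re (Set.mem_singleton_iff.mp h)
    simp at this
    exact hxα this.symm
  have hconth : ∀ y : ℝ, y ≠ 0 →
      ContinuousOn (fun x : ℝ => Φ (x + y * Complex.I)) (Set.Ici b) := by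
    intro y hy
    refine hΦ.continuousOn.comp (by fun_prop) fun x hx => ⟨by simpa using hx, ?_⟩
    intro h
    have := congrArg Complex.im (Set.mem_singleton_iff.mp h)
    simp at this
    exact hy this
  have hinth : ∀ y : ℝ, y ≠ 0 → ∀ u v : ℝ, b ≤ u → u ≤ v →
      IntervalIntegrable (fun x : ℝ => Φ (x + y * Complex.I)) volume u v := by
    intro y hy u v hu huv
    refine ContinuousOn.intervalIntegrable ((hconth y hy).mono ?_)
    rw [Set.uIcc_of_le huv]
    exact fun x hx => hu.trans hx.1
  have hbound : ∀ᶠ T : ℝ in atTop, ‖∫ t in (-T)..T, Φ (c + t * Complex.I)‖ ≤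
      (∫ t, g t) + 2 * Hb + 2 * r * Mb + 2 * (c - b) * ε T := by
    filter_upwards [hfar, eventually_gt_atTop r] with T hT hrT
    -- Cauchy's theorem on three rectangles avoiding `α`: below it, to its right, and above it. No
    -- residue is computed.
    have hbot := hrect b c (-T) (-r) le_rfl hbc (by linarith) (Or.inr (Or.inl (by linarith)))
    have hmd := hrect (α + r) c (-r) r hbp hrc (by linarith) (Or.inr (Or.inr (by linarith)))
    have htop := hrect b c r T le_rfl hbc hrT.le (Or.inl hr)
    have hcc := hcontv c hbc (by linarith)
    have s1 : (∫ t in (-T)..(-r), Φ (c + t * Complex.I)) + (∫ t in (-r)..r, Φ (c + t * Complex.I)) +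
        (∫ t in r..T, Φ (c + t * Complex.I)) = ∫ t in (-T)..T, Φ (c + t * Complex.I) := by
      rw [integral_add_adjacent_intervals (hcc.intervalIntegrable _ _) (hcc.intervalIntegrable _ _),
        integral_add_adjacent_intervals (hcc.intervalIntegrable _ _) (hcc.intervalIntegrable _ _)]
    have s2 : ∀ y : ℝ, y ≠ 0 → (∫ x in b..c, Φ (x + y * Complex.I)) =
        (∫ x in b..(α + r), Φ (x + y * Complex.I)) + ∫ x in (α + r)..c, Φ (x + y * Complex.I) :=
      fun y hy => (integral_add_adjacent_intervals (hinth y hy _ _ le_rfl hbp)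
        (hinth y hy _ _ hbp hrc)).symm
    have s3 := s2 r hr.ne'
    have s4 := s2 (-r) (neg_ne_zero.mpr hr.ne')
    have key : Complex.I * (∫ t in (-T)..T, Φ (c + t * Complex.I)) =
        Complex.I * (∫ t in (-T)..(-r), Φ (b + t * Complex.I)) +
        Complex.I * (∫ t in r..T, Φ (b + t * Complex.I)) +
        Complex.I * (∫ t in (-r)..r, Φ ((α + r : ℝ) + t * Complex.I)) +
        (∫ x in b..(α + r), Φ (x + (-r : ℝ) * Complex.I)) -
        (∫ x in b..(α + r), Φ (x + (r : ℝ) * Complex.I)) -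
        (∫ x in b..c, Φ (x + (-T : ℝ) * Complex.I)) + ∫ x in b..c, Φ (x + T * Complex.I) := by
      rw [← s1]
      simp only [smul_eq_mul] at hbot hmd htop
      linear_combination hbot + hmd + htop + s4 - s3
    have n1 : ‖∫ t in (-T)..(-r), Φ (b + t * Complex.I)‖ ≤ ∫ t in (-T)..(-r), g t :=
      norm_integral_le_of_norm_le (by linarith) (ae_of_all _ fun t ht => hleft t (by
        rw [abs_of_nonpos (by linarith [ht.2])]; linarith [ht.2])) hg.intervalIntegrable
    have n2 : ‖∫ t in r..T, Φ (b + t * Complex.I)‖ ≤ ∫ t in r..T, g t :=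
      norm_integral_le_of_norm_le hrT.le (ae_of_all _ fun t ht => hleft t (by
        rw [abs_of_nonneg (by linarith [ht.1])]; exact ht.1.le)) hg.intervalIntegrable
    have n12 : (∫ t in (-T)..(-r), g t) + (∫ t in r..T, g t) ≤ ∫ t, g t := by
      have e1 : (∫ t in (-T)..(-r), g t) + (∫ t in (-r)..r, g t) + (∫ t in r..T, g t) =
          ∫ t in (-T)..T, g t := by
        rw [integral_add_adjacent_intervals hg.intervalIntegrable hg.intervalIntegrable,
          integral_add_adjacent_intervals hg.intervalIntegrable hg.intervalIntegrable]
      have e2 : 0 ≤ ∫ t in (-r)..r, g t :=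
        intervalIntegral.integral_nonneg (by linarith) fun t _ => hg0 t
      have e3 : ∫ t in (-T)..T, g t ≤ ∫ t, g t := by
        rw [intervalIntegral.integral_of_le (by linarith)]
        exact setIntegral_le_integral hg (ae_of_all _ hg0)
      linarith
    have n3 : ‖∫ t in (-r)..r, Φ ((α + r : ℝ) + t * Complex.I)‖ ≤ Mb * |r - -r| :=
      norm_integral_le_of_norm_le_const fun t ht => by
        rw [Set.uIoc_of_le (by linarith)] at ht
        exact hmid t (abs_le.mpr ⟨ht.1.le, ht.2⟩)
    rw [show r - -r = 2 * r by ring, abs_of_pos (by linarith)] at n3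
    have n4 : ‖∫ x in b..(α + r), Φ (x + (-r : ℝ) * Complex.I)‖ ≤ Hb :=
      (norm_integral_le_of_norm_le hbp (ae_of_all _ fun x hx => hhor₂ x hx.1.le hx.2)
        (hk.intervalIntegrable _ _)).trans hkH
    have n5 : ‖∫ x in b..(α + r), Φ (x + (r : ℝ) * Complex.I)‖ ≤ Hb :=
      (norm_integral_le_of_norm_le hbp (ae_of_all _ fun x hx => hhor₁ x hx.1.le hx.2)
        (hk.intervalIntegrable _ _)).trans hkH
    have n6 : ‖∫ x in b..c, Φ (x + T * Complex.I)‖ ≤ ε T * |c - b| :=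
      norm_integral_le_of_norm_le_const fun x hx => by
        rw [Set.uIoc_of_le hbc] at hx
        exact (hT x hx.1.le hx.2).1
    have n7 : ‖∫ x in b..c, Φ (x + (-T : ℝ) * Complex.I)‖ ≤ ε T * |c - b| :=
      norm_integral_le_of_norm_le_const fun x hx => by
        rw [Set.uIoc_of_le hbc] at hx
        exact (hT x hx.1.le hx.2).2
    rw [abs_of_nonneg (by linarith)] at n6 n7
    have nI : ∀ z : ℂ, ‖Complex.I * z‖ = ‖z‖ := fun z => by simp
    rw [← nI, key]
    refine (norm_add_le _ _).trans ?_
    refine (add_le_add_left (norm_sub_le _ _) _).trans ?_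
    refine (add_le_add_left (add_le_add_left (norm_sub_le _ _) _) _).trans ?_
    refine (add_le_add_left (add_le_add_left (add_le_add_left (norm_add_le _ _) _) _) _).trans ?_
    have n8 := norm_add₃_le (a := Complex.I * (∫ t in (-T)..(-r), Φ (b + t * Complex.I)))
      (b := Complex.I * (∫ t in r..T, Φ (b + t * Complex.I)))
      (c := Complex.I * (∫ t in (-r)..r, Φ ((α + r : ℝ) + t * Complex.I)))
    rw [nI, nI, nI] at n8
    linarith
  have hlim : Tendsto (fun T : ℝ => ‖∫ t in (-T)..T, Φ (c + t * Complex.I)‖) atTop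
      (𝓝 ‖∫ t : ℝ, Φ (c + t * Complex.I)‖) :=
    (intervalIntegral_tendsto_integral hint tendsto_neg_atTop_atBot tendsto_id).norm
  refine le_of_tendsto_of_tendsto hlim ?_ hbound
  have := (hε.const_mul (2 * (c - b))).const_add ((∫ t, g t) + 2 * Hb + 2 * r * Mb)
  simpa using this

end Contour

end Smoothing

/-! ### Estimates on the shifted contour and the choice of `h`. -/

section Bound

open MeasureTheory intervalIntegral Filter Topology

section Estimates

variable {α δ κ C K h y : ℝ} {m N : ℕ} {lam a : ℕ+ → ℝ} {F : ℂ → ℂ}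

lemma one_le_log_three_add {x : ℝ} (hx : 0 ≤ x) : 1 ≤ Real.log (3 + x) := by
  rw [Real.le_log_iff_exp_le (by linarith)]
  linarith [Real.exp_one_lt_d9]

/-- Polynomial growth in `|t|` against the Gaussian `exp (-h² t² / 2)`. -/
lemma growth_mul_gaussian_le (hκ : 0 ≤ κ) (h0 : 0 < h) (h1 : h ≤ 1) (t : ℝ) (j : ℕ) :
    (1 + |t|) ^ κ * Real.log (3 + |t|) ^ j * Real.exp (-(h ^ 2 * t ^ 2 / 2)) ≤
      ((⌈κ⌉₊ + j).factorial * Real.exp 2) * (h ^ (-κ) * Real.log (3 + 1 / h) ^ j) *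
        Real.exp (-(h ^ 2 / 4) * t ^ 2) := by
  have ht := abs_nonneg t
  set u : ℝ := h * |t| with hu
  have hu0 : 0 ≤ u := by positivity
  have hu2 : h ^ 2 * t ^ 2 = u ^ 2 := by rw [hu, mul_pow, sq_abs]
  set l := Real.log (3 + 1 / h) with hl
  have hl1 : 1 ≤ l := one_le_log_three_add (by positivity)
  have e1 : (1 + |t|) ^ κ ≤ h ^ (-κ) * (1 + u) ^ ⌈κ⌉₊ := by
    have : 1 + |t| ≤ h⁻¹ * (1 + u) := by
      rw [← div_eq_inv_mul, le_div_iff₀ h0, hu]; nlinarith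
    calc (1 + |t|) ^ κ ≤ (h⁻¹ * (1 + u)) ^ κ := Real.rpow_le_rpow (by positivity) this hκ
      _ = h ^ (-κ) * (1 + u) ^ κ := by
        rw [Real.mul_rpow (by positivity) (by positivity), Real.inv_rpow h0.le,
          ← Real.rpow_neg h0.le]
      _ ≤ h ^ (-κ) * (1 + u) ^ ⌈κ⌉₊ := by
        rw [← Real.rpow_natCast]
        exact mul_le_mul_of_nonneg_left
          (Real.rpow_le_rpow_of_exponent_le (by linarith) (Nat.le_ceil κ)) (by positivity)
  have e2 : Real.log (3 + |t|) ≤ l * (1 + u) := by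
    have h2 : 3 + |t| ≤ (3 + 1 / h) * (1 + u) := by
      have : (3 + 1 / h) * (1 + u) = 3 + |t| + (1 / h + 3 * u) := by rw [hu]; field_simp; ring
      rw [this]; have : 0 ≤ 1 / h + 3 * u := by positivity
      linarith
    calc Real.log (3 + |t|) ≤ Real.log ((3 + 1 / h) * (1 + u)) :=
          Real.log_le_log (by linarith) h2
      _ = l + Real.log (1 + u) := Real.log_mul (by positivity) (by positivity)
      _ ≤ l * (1 + u) := by
        have := Real.log_le_sub_one_of_pos (by linarith : 0 < 1 + u)
        nlinarith
  have e3 : (1 + u) ^ (⌈κ⌉₊ + j) ≤ (⌈κ⌉₊ + j).factorial * Real.exp (1 + u) := by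
    have := Real.pow_div_factorial_le_exp (1 + u) (by linarith) (⌈κ⌉₊ + j)
    rwa [div_le_iff₀ (by positivity), mul_comm] at this
  have e4 : Real.exp (1 + u) * Real.exp (-(u ^ 2 / 2)) ≤
      Real.exp 2 * Real.exp (-(h ^ 2 / 4) * t ^ 2) := by
    rw [← Real.exp_add, ← Real.exp_add]
    refine Real.exp_le_exp.mpr ?_
    have : -(h ^ 2 / 4) * t ^ 2 = -(u ^ 2 / 4) := by rw [← hu2]; ring
    -- `1 + u - u²/2 ≤ 2 - u²/4` is `(u - 2)² ≥ 0`: half of the Gaussian pays for the polynomial.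
    rw [this]; nlinarith [sq_nonneg (u - 2)]
  have hlog0 : 0 ≤ Real.log (3 + |t|) := zero_le_one.trans (one_le_log_three_add ht)
  have hhκ : 0 ≤ h ^ (-κ) := Real.rpow_nonneg h0.le _
  calc (1 + |t|) ^ κ * Real.log (3 + |t|) ^ j * Real.exp (-(h ^ 2 * t ^ 2 / 2))
      ≤ (h ^ (-κ) * (1 + u) ^ ⌈κ⌉₊) * (l * (1 + u)) ^ j * Real.exp (-(u ^ 2 / 2)) := by
        rw [hu2]; gcongr
    _ = (h ^ (-κ) * l ^ j) * ((1 + u) ^ (⌈κ⌉₊ + j) * Real.exp (-(u ^ 2 / 2))) := by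
        rw [mul_pow, pow_add]; ring
    _ ≤ (h ^ (-κ) * l ^ j) *
        (((⌈κ⌉₊ + j).factorial * Real.exp (1 + u)) * Real.exp (-(u ^ 2 / 2))) := by gcongr
    _ = (h ^ (-κ) * l ^ j) * (⌈κ⌉₊ + j).factorial * (Real.exp (1 + u) * Real.exp (-(u ^ 2 / 2))) := by
        ring
    _ ≤ (h ^ (-κ) * l ^ j) * (⌈κ⌉₊ + j).factorial *
        (Real.exp 2 * Real.exp (-(h ^ 2 / 4) * t ^ 2)) := by gcongr
    _ = _ := by ring

/-- The integrand decays to the left of `α` at scale `r`, so the horizontal sides of the indentation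
count as having length about `r`. This saves one factor `1 + y` and turns `(1 + y)^m` into `(1 +
y)^{m-1}`. -/
lemma integral_exp_div_le {r : ℝ} (hr : 0 < r) :
    ∫ x in (α - δ)..(α + r), Real.exp ((x - α) / r) ≤ r * Real.exp 1 := by
  have h : ∀ x ∈ Set.uIcc (α - δ) (α + r),
      HasDerivAt (fun x => r * Real.exp ((x - α) / r)) (Real.exp ((x - α) / r)) x := by
    intro x _
    have := ((((hasDerivAt_id x).sub_const α).div_const r).exp).const_mul r
    convert! this using 1
    simp only [id]
    field_simp
  rw [integral_eq_sub_of_hasDerivAt h (by apply Continuous.intervalIntegrable; fun_prop)]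
  rw [add_sub_cancel_left, div_self hr.ne']
  have : 0 ≤ r * Real.exp ((α - δ - α) / r) := by positivity
  linarith

/-- Bound for the integrand near the pole. -/
lemma norm_mul_gaussKernel_near_le (hδ : 0 < δ) (hK : 0 ≤ K) (h0 : 0 < h) (h1 : h ≤ 1)
    {r : ℝ} (hr : 0 < r) (hr1 : r ≤ 1) (hry : r⁻¹ = 1 + y)
    (hF : ∀ s : ℂ, s ≠ α → α - δ ≤ s.re → s.re ≤ α + 1 → ‖s - α‖ ^ m * ‖F s‖ ≤
          K * ‖s - ((α - δ - 1 : ℝ) : ℂ)‖ ^ N)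
    {s : ℂ} (hs1 : α - δ ≤ s.re) (hs2 : s.re ≤ α + r) (hs3 : |s.im| ≤ r) (hs4 : r ≤ ‖s - α‖) :
    ‖F s * gaussKernel h y (s - α)‖ ≤
      K * (δ + 3) ^ N * Real.exp ((δ + 1) ^ 2 / 2 + δ) * (1 + y) ^ m *
        Real.exp ((s.re - α) / r) := by
  have hsα : s ≠ α := by rintro rfl; simp at hs4; linarith
  have hβ : ‖s - ((α - δ - 1 : ℝ) : ℂ)‖ ≤ δ + 3 := by
    refine (Complex.norm_le_abs_re_add_abs_im _).trans ?_
    simp only [Complex.sub_re, Complex.sub_im, Complex.ofReal_re, Complex.ofReal_im, sub_zero]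
    rw [abs_of_nonneg (by linarith)]; linarith
  have hFs : ‖F s‖ ≤ K * (δ + 3) ^ N * (1 + y) ^ m := by
    have h2 := hF s hsα hs1 (by linarith)
    have h3 : r ^ m * ‖F s‖ ≤ K * (δ + 3) ^ N := by
      calc r ^ m * ‖F s‖ ≤ ‖s - α‖ ^ m * ‖F s‖ := by gcongr
        _ ≤ _ := h2
        _ ≤ K * (δ + 3) ^ N := by gcongr
    rw [← hry, inv_pow, ← div_eq_mul_inv, le_div_iff₀ (by positivity), mul_comm]
    exact h3
  have hE : ‖gaussKernel h y (s - α)‖ ≤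
      Real.exp ((δ + 1) ^ 2 / 2 + δ) * Real.exp ((s.re - α) / r) := by
    rw [norm_gaussKernel, ← Real.exp_add]
    refine Real.exp_le_exp.mpr ?_
    simp only [Complex.sub_re, Complex.sub_im, Complex.ofReal_re, Complex.ofReal_im, sub_zero]
    set u := s.re - α with hu
    have hu1 : -δ ≤ u := by linarith
    have hu2 : u ≤ 1 := by linarith
    -- Since `y = 1/r - 1`, one has `u y = u/r - u ≤ u/r + δ`.
    rw [div_eq_mul_inv u r, hry]
    have hh : h ^ 2 ≤ 1 := pow_le_one₀ h0.le h1
    have hsq : u ^ 2 ≤ (δ + 1) ^ 2 := by nlinarith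
    have : h ^ 2 / 2 * (u ^ 2 - s.im ^ 2) ≤ (δ + 1) ^ 2 / 2 := by
      nlinarith [sq_nonneg s.im, sq_nonneg h, mul_nonneg (sq_nonneg h) (sq_nonneg s.im),
        mul_le_mul hh hsq (sq_nonneg u) zero_le_one]
    linarith
  rw [norm_mul]
  calc ‖F s‖ * ‖gaussKernel h y (s - α)‖ ≤ (K * (δ + 3) ^ N * (1 + y) ^ m) *
      (Real.exp ((δ + 1) ^ 2 / 2 + δ) * Real.exp ((s.re - α) / r)) := by
        refine mul_le_mul hFs hE (norm_nonneg _) ((norm_nonneg _).trans hFs)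
    _ = _ := by ring

/-- Bound for the integrand at large height. -/
lemma norm_mul_gaussKernel_far_le (hδ : 0 < δ) (hK : 0 ≤ K) (h0 : 0 < h) (h1 : h ≤ 1)
    (hy : 0 ≤ y)
    (hF : ∀ s : ℂ, s ≠ α → α - δ ≤ s.re → s.re ≤ α + 1 → ‖s - α‖ ^ m * ‖F s‖ ≤
          K * ‖s - ((α - δ - 1 : ℝ) : ℂ)‖ ^ N)
    {s : ℂ} {T : ℝ} (hs1 : α - δ ≤ s.re) (hs2 : s.re ≤ α + 1) (hsT : |s.im| = T) (hT1 : 1 ≤ T)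
    (hT : 2 / h ^ 2 ≤ T) :
    ‖F s * gaussKernel h y (s - α)‖ ≤
      K * Real.exp ((δ + 1) ^ 2 / 2 + y + (δ + 2)) *
        ((T + (δ + 2)) ^ N * Real.exp (-(T + (δ + 2)))) := by
  have hsα' : 1 ≤ ‖s - α‖ := by
    refine le_trans ?_ (Complex.abs_im_le_norm _)
    simp only [Complex.sub_im, Complex.ofReal_im, sub_zero]
    linarith
  have hsα : s ≠ α := by
    rintro rfl
    rw [sub_self, norm_zero] at hsα'; linarith
  have hβ : ‖s - ((α - δ - 1 : ℝ) : ℂ)‖ ≤ T + (δ + 2) := by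
    refine (Complex.norm_le_abs_re_add_abs_im _).trans ?_
    simp only [Complex.sub_re, Complex.sub_im, Complex.ofReal_re, Complex.ofReal_im, sub_zero]
    rw [abs_of_nonneg (by linarith)]; linarith
  have hFs : ‖F s‖ ≤ K * (T + (δ + 2)) ^ N := by
    calc ‖F s‖ ≤ ‖s - α‖ ^ m * ‖F s‖ := le_mul_of_one_le_left (norm_nonneg _) (one_le_pow₀ hsα')
      _ ≤ _ := hF s hsα hs1 hs2
      _ ≤ _ := by gcongr
  have hE : ‖gaussKernel h y (s - α)‖ ≤ Real.exp ((δ + 1) ^ 2 / 2 + y + (δ + 2)) *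
      Real.exp (-(T + (δ + 2))) := by
    rw [norm_gaussKernel, ← Real.exp_add]
    refine Real.exp_le_exp.mpr ?_
    simp only [Complex.sub_re, Complex.sub_im, Complex.ofReal_re, Complex.ofReal_im, sub_zero]
    rw [← sq_abs s.im, hsT]
    set u := s.re - α with hu
    have hu1 : -δ ≤ u := by linarith
    have hu2 : u ≤ 1 := by linarith
    have hh : h ^ 2 ≤ 1 := pow_le_one₀ h0.le h1
    have hsq : u ^ 2 ≤ (δ + 1) ^ 2 := by nlinarith
    have e1 : h ^ 2 * u ^ 2 ≤ (δ + 1) ^ 2 := by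
      nlinarith [mul_le_mul hh hsq (sq_nonneg u) zero_le_one]
    have e2 : u * y ≤ y := by nlinarith
    have e3 : 2 * T ≤ h ^ 2 * T ^ 2 := by
      rw [div_le_iff₀ (by positivity)] at hT
      nlinarith
    nlinarith
  rw [norm_mul]
  calc ‖F s‖ * ‖gaussKernel h y (s - α)‖ ≤ (K * (T + (δ + 2)) ^ N) *
      (Real.exp ((δ + 1) ^ 2 / 2 + y + (δ + 2)) * Real.exp (-(T + (δ + 2)))) :=
        mul_le_mul hFs hE (norm_nonneg _) ((norm_nonneg _).trans hFs)
    _ = _ := by ring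

/-- The smoothed sum at height `h` and position `y` is bounded by the contribution of the pole and
that of the line `Re s = α - δ`. -/
lemma IsHypothesisBContinuation.norm_integral_le (hδ : 0 < δ) (hκ : 0 ≤ κ)
    (hm : 1 ≤ m) (hC : 0 ≤ C) (hK : 0 ≤ K) (hB : IsHypothesisBContinuation α δ κ m C lam a F)
    (hF : ∀ s : ℂ, s ≠ α → α - δ ≤ s.re → s.re ≤ α + 1 → ‖s - α‖ ^ m * ‖F s‖ ≤
          K * ‖s - ((α - δ - 1 : ℝ) : ℂ)‖ ^ N)
    (h0 : 0 < h) (h1 : h ≤ 1) (hy : 0 ≤ y) :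
    ‖∫ t : ℝ, F (α + (1 + t * Complex.I)) * gaussKernel h y (1 + t * Complex.I)‖ ≤
      4 * Real.exp 1 * (K * (δ + 3) ^ N * Real.exp ((δ + 1) ^ 2 / 2 + δ)) * (1 + y) ^ (m - 1) +
      (C * Real.exp (δ ^ 2 / 2) * ((⌈κ⌉₊ + (m - 1)).factorial * Real.exp 2) *
        Real.sqrt (4 * Real.pi)) *
        (Real.exp (-(δ * y)) * h ^ (-(κ + 1)) * Real.log (3 + 1 / h) ^ (m - 1)) := by
  set Φ : ℂ → ℂ := fun s => F s * gaussKernel h y (s - α) with hΦ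
  have hlineeq : ∀ t : ℝ, F (α + (1 + t * Complex.I)) * gaussKernel h y (1 + t * Complex.I) =
      Φ ((α + 1 : ℝ) + t * Complex.I) := by
    intro t
    have : ((α + 1 : ℝ) : ℂ) + t * Complex.I = α + (1 + t * Complex.I) := by push_cast; ring
    simp only [hΦ, this, add_sub_cancel_left]
  have hint := hB.cont.integrable_mul_gaussKernel hδ hB.frequency hB.nonneg h0 y
  simp_rw [hlineeq] at hint ⊢
  -- At this distance from the pole, `exp (r y) ≤ e`, while `r^{-m} = (1 + y)^m`.
  set r : ℝ := (1 + y)⁻¹ with hr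
  have hr0 : 0 < r := by positivity
  have hr1 : r ≤ 1 := inv_le_one_of_one_le₀ (by linarith)
  have hry : r⁻¹ = 1 + y := inv_inv _
  set K' : ℝ := K * (δ + 3) ^ N * Real.exp ((δ + 1) ^ 2 / 2 + δ) with hK'
  have hK'0 : 0 ≤ K' := by positivity
  set A : ℝ := C * Real.exp (δ ^ 2 / 2) * ((⌈κ⌉₊ + (m - 1)).factorial * Real.exp 2) *
    (Real.exp (-(δ * y)) * (h ^ (-κ) * Real.log (3 + 1 / h) ^ (m - 1))) with hA
  have hl0 : 0 ≤ Real.log (3 + 1 / h) := zero_le_one.trans (one_le_log_three_add (by positivity))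
  have hA0 : 0 ≤ A := by positivity
  have hgint : Integrable fun t : ℝ => A * Real.exp (-(h ^ 2 / 4) * t ^ 2) :=
    (integrable_exp_neg_mul_sq (by positivity)).const_mul A
  have hnear : ∀ s : ℂ, α - δ ≤ s.re → s.re ≤ α + r → |s.im| ≤ r → r ≤ ‖s - α‖ →
      ‖Φ s‖ ≤ K' * (1 + y) ^ m * Real.exp ((s.re - α) / r) := fun s a1 a2 a3 a4 =>
    norm_mul_gaussKernel_near_le hδ hK h0 h1 hr0 hr1 hry hF a1 a2 a3 a4
  have hhor : ∀ ρ : ℝ, |ρ| = r → ∀ x : ℝ, α - δ ≤ x → x ≤ α + r →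
      ‖Φ (x + ρ * Complex.I)‖ ≤ K' * (1 + y) ^ m * Real.exp ((x - α) / r) := by
    intro ρ hρ x hx1 hx2
    have := hnear (x + ρ * Complex.I) (by simpa using hx1) (by simpa using hx2)
      (by simpa using hρ.le) (by
        refine le_trans ?_ (Complex.abs_im_le_norm _)
        simpa using hρ.ge)
    simpa using this
  have hmain := norm_integral_vertical_le_of_indented (Φ := Φ) (α := α) (b := α - δ) (c := α + 1)
    (r := r) (Hb := K' * (1 + y) ^ m * (r * Real.exp 1)) (Mb := K' * (1 + y) ^ m * Real.exp 1)
    (g := fun t => A * Real.exp (-(h ^ 2 / 4) * t ^ 2))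
    (k := fun x => K' * (1 + y) ^ m * Real.exp ((x - α) / r))
    (ε := fun T => K * Real.exp ((δ + 1) ^ 2 / 2 + y + (δ + 2)) *
        ((T + (δ + 2)) ^ N * Real.exp (-(T + (δ + 2)))))
    (by linarith) hr0 (by linarith)
    (hB.cont.analytic.differentiableOn.mul
      (((differentiable_gaussKernel h y).comp (by fun_prop)).differentiableOn)) hint hgint
    (fun t => by positivity) ?_ (by fun_prop) ?_ (hhor r (abs_of_pos hr0))
    (hhor (-r) (by rw [abs_neg, abs_of_pos hr0])) ?_ ?_ ?_
  · refine hmain.trans (le_of_eq ?_)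
    rw [MeasureTheory.integral_const_mul, integral_gaussian]
    have e1 : Real.sqrt (Real.pi / (h ^ 2 / 4)) = Real.sqrt (4 * Real.pi) * h⁻¹ := by
      rw [show Real.pi / (h ^ 2 / 4) = 4 * Real.pi / h ^ 2 by field_simp,
        Real.sqrt_div (by positivity), Real.sqrt_sq h0.le, div_eq_mul_inv]
    have e2 : h ^ (-(κ + 1)) = h ^ (-κ) * h⁻¹ := by
      rw [neg_add, Real.rpow_add h0, Real.rpow_neg_one]
    have e3 : (1 + y) ^ m * r = (1 + y) ^ (m - 1) := by
      obtain ⟨j, rfl⟩ : ∃ j, m = j + 1 := ⟨m - 1, by omega⟩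
      rw [hr, pow_succ, Nat.add_sub_cancel, mul_assoc, mul_inv_cancel₀ (by positivity), mul_one]
    rw [e1, e2, ← e3, hA]; ring
  · intro t ht
    have hre : (((α - δ : ℝ) : ℂ) + t * Complex.I).re = α - δ := by simp
    have him : (((α - δ : ℝ) : ℂ) + t * Complex.I).im = t := by simp
    have hed := hB.edge _ hre
    rw [him] at hed
    simp only [hΦ]
    rw [norm_mul, norm_gaussKernel]
    simp only [Complex.sub_re, Complex.sub_im, hre, him, Complex.ofReal_re, Complex.ofReal_im,
      sub_zero]
    have hgr := growth_mul_gaussian_le hκ h0 h1 t (m - 1)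
    have hexp : Real.exp (h ^ 2 / 2 * ((α - δ - α) ^ 2 - t ^ 2) + (α - δ - α) * y) ≤
        Real.exp (δ ^ 2 / 2) * Real.exp (-(δ * y)) * Real.exp (-(h ^ 2 * t ^ 2 / 2)) := by
      rw [← Real.exp_add, ← Real.exp_add]
      refine Real.exp_le_exp.mpr ?_
      have hh : h ^ 2 ≤ 1 := pow_le_one₀ h0.le h1
      nlinarith [mul_le_mul_of_nonneg_right hh (sq_nonneg δ)]
    have hlog0 : 0 ≤ Real.log (3 + |t|) := zero_le_one.trans (one_le_log_three_add (abs_nonneg t))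
    calc _ ≤ (C * (1 + |t|) ^ κ * Real.log (3 + |t|) ^ (m - 1)) *
          (Real.exp (δ ^ 2 / 2) * Real.exp (-(δ * y)) * Real.exp (-(h ^ 2 * t ^ 2 / 2))) :=
          mul_le_mul hed hexp (Real.exp_pos _).le (by positivity)
      _ = C * Real.exp (δ ^ 2 / 2) * Real.exp (-(δ * y)) * ((1 + |t|) ^ κ *
          Real.log (3 + |t|) ^ (m - 1) * Real.exp (-(h ^ 2 * t ^ 2 / 2))) := by ring
      _ ≤ C * Real.exp (δ ^ 2 / 2) * Real.exp (-(δ * y)) * _ :=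
          mul_le_mul_of_nonneg_left hgr (by positivity)
      _ = A * Real.exp (-(h ^ 2 / 4) * t ^ 2) := by rw [hA]; ring
  · rw [intervalIntegral.integral_const_mul]
    exact mul_le_mul_of_nonneg_left (integral_exp_div_le hr0) (by positivity)
  · intro t ht
    have := hnear ((α + r : ℝ) + t * Complex.I) (by simp; linarith) (by simp) (by simpa using ht)
      (by
        refine le_trans ?_ (Complex.re_le_norm _)
        simp)
    have e : (((α + r : ℝ) : ℂ) + t * Complex.I).re = α + r := by simp
    rwa [e, add_sub_cancel_left, div_self hr0.ne'] at this
  · have := ((Real.tendsto_pow_mul_exp_neg_atTop_nhds_zero N).comp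
      (tendsto_atTop_add_const_right atTop (δ + 2) tendsto_id)).const_mul
      (K * Real.exp ((δ + 1) ^ 2 / 2 + y + (δ + 2)))
    rw [mul_zero] at this
    exact this
  · filter_upwards [eventually_ge_atTop 1, eventually_ge_atTop (2 / h ^ 2)] with T hT1 hT2 x hx1 hx2
    constructor <;>
    · refine norm_mul_gaussKernel_far_le hδ hK h0 h1 hy hF (by simpa using hx1)
        (by simpa using hx2) ?_ hT1 hT2
      simp
      linarith

/-- Uniform coefficient bound with `(1 + log λₙ)^{m-1}` in place of `(log λₙ)^{m-1}`. -/
theorem exists_uniform_coeff_bound (α δ κ C : ℝ) (m : ℕ) (hδ : 0 < δ) (hδα : δ < α)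
    (hκ : 0 ≤ κ) (hm : 1 ≤ m) (hC : 1 ≤ C) :
    ∃ K : ℝ, 0 < K ∧ ∀ lam a : ℕ+ → ℝ, HypothesisB α δ κ m C lam a → ∀ n : ℕ+,
      a n ≤ K * (lam n ^ (α - δ / (κ + 1)) * (1 + Real.log (lam n)) ^ (m - 1)) := by
  obtain ⟨K, hK, hKF⟩ := exists_uniform_strip_bound α δ κ C m hδ hδα hκ hm hC
  set K₁ := 4 * Real.exp 1 *
    (K * (δ + 3) ^ (m + ⌈κ⌉₊ + m) * Real.exp ((δ + 1) ^ 2 / 2 + δ)) with hK₁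
  set K₂ := C * Real.exp (δ ^ 2 / 2) * ((⌈κ⌉₊ + (m - 1)).factorial * Real.exp 2) *
        Real.sqrt (4 * Real.pi) with hK₂
  set θ := δ / (κ + 1) with hθ
  have hθ0 : 0 < θ := by positivity
  have hθδ : θ * (κ + 1) = δ := by rw [hθ]; field_simp
  refine ⟨K₁ + K₂ * (3 + θ) ^ (m - 1), by positivity, fun lam a hB n => ?_⟩
  obtain ⟨F, hF⟩ := hB.exists_continuation
  have hl := hF.frequency.pos n
  set y := Real.log (lam n) with hy
  have hy0 : 0 ≤ y := Real.log_nonneg (hF.frequency.one_le' n)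
  have hexpy : Real.exp y = lam n := Real.exp_log hl
  -- `h = λₙ^{-θ}` is chosen so that `exp (-δy) h^{-(κ+1)} = 1`: up to powers of logarithms, the
  -- pole and the line then contribute equally.
  set h := Real.exp (-(θ * y)) with hh
  have h0 : 0 < h := Real.exp_pos _
  have h1 : h ≤ 1 := Real.exp_le_one_iff.mpr (by have := mul_nonneg hθ0.le hy0; linarith)
  have hJ := hF.norm_integral_le hδ hκ hm (by linarith) hK.le (hKF lam a F hF) h0 h1 hy0
  have hcoeff := hF.cont.coeff_le_norm_integral hδ hF.frequency hF.nonneg h0 n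
  have e1 : Real.exp (-(δ * y)) * h ^ (-(κ + 1)) = 1 := by
    rw [hh, ← Real.exp_mul, ← Real.exp_add, Real.exp_eq_one_iff, ← hθδ]; ring
  have e2 : Real.log (3 + 1 / h) ≤ (3 + θ) * (1 + y) := by
    have h2 : 1 / h = Real.exp (θ * y) := by rw [hh, one_div, ← Real.exp_neg, neg_neg]
    have h3 : 1 ≤ Real.exp (θ * y) := Real.one_le_exp (by positivity)
    calc Real.log (3 + 1 / h) ≤ Real.log (4 * Real.exp (θ * y)) := by
          refine Real.log_le_log (by positivity) ?_
          rw [h2]; linarith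
      _ = Real.log 4 + θ * y := by rw [Real.log_mul (by norm_num) (by positivity), Real.log_exp]
      _ ≤ (3 + θ) * (1 + y) := by
        have := Real.log_le_sub_one_of_pos (by norm_num : (0 : ℝ) < 4)
        nlinarith
  have hlog0 : 0 ≤ Real.log (3 + 1 / h) := zero_le_one.trans (one_le_log_three_add (by positivity))
  rw [e1, one_mul] at hJ
  have hJ' : ‖∫ t : ℝ, F (α + (1 + t * Complex.I)) * gaussKernel h y (1 + t * Complex.I)‖ ≤
      (K₁ + K₂ * (3 + θ) ^ (m - 1)) * (1 + y) ^ (m - 1) := by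
    refine hJ.trans ?_
    rw [add_mul, mul_assoc K₂, ← mul_pow]
    gcongr
  have e3 : h * lam n ^ α = lam n ^ (α - θ) := by
    rw [hh, ← hexpy, ← Real.exp_mul, ← Real.exp_mul, ← Real.exp_add]; congr 1; ring
  have e4 : a n = a n * lam n ^ (-α) * lam n ^ α := by
    rw [mul_assoc, ← Real.rpow_add hl, neg_add_cancel, Real.rpow_zero, mul_one]
  rw [e4]
  calc a n * lam n ^ (-α) * lam n ^ α
      ≤ (h * ((K₁ + K₂ * (3 + θ) ^ (m - 1)) * (1 + y) ^ (m - 1))) * lam n ^ α := by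
        refine mul_le_mul_of_nonneg_right (hcoeff.trans ?_) (Real.rpow_nonneg hl.le _)
        gcongr
    _ = (K₁ + K₂ * (3 + θ) ^ (m - 1)) * ((h * lam n ^ α) * (1 + y) ^ (m - 1)) := by ring
    _ = _ := by rw [e3]

end Estimates

/-! ### Replacing `1 + log λₙ` by `log λₙ`. -/

/-- For `b > 1`, `1 ≤ log x / log b`; for `m = 1` both powers are trivial. The absolute value makes
the constant positive without a sign condition on `log b`. -/
lemma one_add_log_pow_le {b x : ℝ} {m : ℕ} (hb : m = 1 ∨ 1 < b) (hbx : b ≤ x) :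
    (1 + Real.log x) ^ (m - 1) ≤ (1 + 1 / |Real.log b|) ^ (m - 1) * Real.log x ^ (m - 1) := by
  rcases hb with rfl | hb
  · simp
  · have hlb : 0 < Real.log b := Real.log_pos hb
    have hlx : Real.log b ≤ Real.log x := Real.log_le_log (by linarith) hbx
    rw [abs_of_pos hlb, ← mul_pow]
    refine pow_le_pow_left₀ (by linarith) ?_ _
    have : 1 ≤ 1 / Real.log b * Real.log x := by
      rw [one_div, ← div_eq_inv_mul, le_div_iff₀ hlb]; linarith
    linarith

end Bound

theorem mainTheorem5 (α δ κ C : ℝ) (m : ℕ) (hα : 0 < α) (hδ : 0 < δ) (hδα : δ < α)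
    (hκ : 0 ≤ κ) (hm : 1 ≤ m) (hC : 1 ≤ C) :
    (∀ b : ℝ, 1 ≤ b → (m = 1 ∨ 1 < b) →
      ∃ K : ℝ, 0 < K ∧ ∀ lam a : ℕ+ → ℝ, HypothesisB α δ κ m C lam a →
        ∀ n : ℕ+, b ≤ lam n →
          0 ≤ a n ∧
          a n ≤ K * (lam n ^ (α - δ / (κ + 1)) * (Real.log (lam n)) ^ (m - 1))) ∧
    (∀ lam a : ℕ+ → ℝ, HypothesisB α δ κ m C lam a →
      ∃ K : ℝ, 0 < K ∧ ∀ n : ℕ+, 2 ≤ n →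
        0 ≤ a n ∧
        a n ≤ K * (lam n ^ (α - δ / (κ + 1)) * (Real.log (lam n)) ^ (m - 1))) := by
  have part1 : ∀ b : ℝ, 1 ≤ b → (m = 1 ∨ 1 < b) →
      ∃ K : ℝ, 0 < K ∧ ∀ lam a : ℕ+ → ℝ, HypothesisB α δ κ m C lam a →
        ∀ n : ℕ+, b ≤ lam n →
          0 ≤ a n ∧
          a n ≤ K * (lam n ^ (α - δ / (κ + 1)) * (Real.log (lam n)) ^ (m - 1)) := by
    intro b hb1 hb
    obtain ⟨K, hK, hbound⟩ := exists_uniform_coeff_bound α δ κ C m hδ hδα hκ hm hC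
    refine ⟨K * (1 + 1 / |Real.log b|) ^ (m - 1), by positivity, fun lam a hB n hn =>
      ⟨hB.nonneg n, (hbound lam a hB n).trans ?_⟩⟩
    have hl : 0 ≤ lam n ^ (α - δ / (κ + 1)) := Real.rpow_nonneg (by linarith) _
    calc K * (lam n ^ (α - δ / (κ + 1)) * (1 + Real.log (lam n)) ^ (m - 1))
        ≤ K * (lam n ^ (α - δ / (κ + 1)) *
          ((1 + 1 / |Real.log b|) ^ (m - 1) * Real.log (lam n) ^ (m - 1))) := by
          gcongr
          exact one_add_log_pow_le hb hn
      _ = _ := by ring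
  refine ⟨part1, fun lam a hB => ?_⟩
  have hlt : 1 < lam 2 :=
    hB.frequency.one_le.trans_lt (hB.frequency.strictMono (by decide))
  -- `b = λ₂ > λ₁ ≥ 1` is admissible for every `m`; the constant now depends on the series through
  -- `λ₂`.
  obtain ⟨K, hK, hbound⟩ := part1 (lam 2) hlt.le (Or.inr hlt)
  exact ⟨K, hK, fun n hn => hbound lam a hB n (hB.frequency.strictMono.monotone hn)⟩
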